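/- For $n\ge 0$ let $F_n$ be the free group on $x_1,\dots,x_n$ and let $\mathrm{IA}_n$ be the group of automorphisms of $F_n$ acting trivially on the abelianization $F_n^{\mathrm{ab}}$. Let $\mathrm{IA}_\infty=\varinjlim_n \mathrm{IA}_n$, where an automorphism in $\mathrm{IA}_n$ is extended to $F_{n+1}$ by $x_{n+1}\mapsto x_{n+1}$. Let $H(n)=\mathbb{Q}^n$ with basis $e_1,\dots,e_n$ ($e_j$ being the class of $x_j$) and dual basis $e_1^*,\dots,e_n^*$ of $H(n)^*$, let $\mathbf{H}=\bigcup_n H(n)$ and $\mathbf{H}^*=\bigcup_n H(n)^*$ (forms on $H(n)$ being extended by zero), and let $\mathrm{GL}(\infty,\mathbb{Q})=\bigcup_n \mathrm{GL}(n,\mathbb{Q})$, where $A\in \mathrm{GL}(n,\mathbb{Q})$ is identified with $A\oplus 1$; it acts on $\mathbf{H}$ in the standard way and on $\mathbf{H}^*$ by the contragredient action. Put $U=(\bigwedge^2\mathbf{H})\otimes\mathbf{H}^*$. For a group $G$ with abelianization $\pi:G\to G^{\mathrm{ab}}$, the Albanese homology is $$H^A_i(G,\mathbb{Q})=\mathrm{im}\bigl(\pi_*:H_i(G,\mathbb{Q})\to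 H_i(G^{\mathrm{ab}},\mathbb{Q})\bigr).$$ The Johnson homomorphism $\tau:\mathrm{IA}_\infty\to U$ is $\tau(f)=\sum_j [f(x_j)x_j^{-1}]\otimes e_j^*$, where $[w]\in\bigwedge^2\mathbf{H}$ denotes the class of an element $w$ of the commutator subgroup modulo triple commutators, so that the class of $xyx^{-1}y^{-1}$ is the wedge product of the classes of $x$ and $y$ in $\mathbf{H}$. It induces a linear map $$j_i: H^A_i(\mathrm{IA}_\infty,\mathbb{Q})\to H_i(U,\mathbb{Q})\cong\bigwedge^i U .$$ Let $\iota_i:\bigwedge^i U\to(\mathbf{H}^{\otimes 2}\otimes\mathbf{H}^*)^{\otimes i}$ be the map $$u_1\wedge\cdots\wedge u_i\mapsto\sum_{\sigma\in\mathfrak{S}_i}\mathrm{sgn}(\sigma)\,\varphi(u_{\sigma(1)})\otimes\cdots\otimes\varphi(u_{\sigma(i)}),\qquad \varphi((a\wedge b)\otimes d)=(a\otimes b-b\otimes a)\otimes d,$$ and let $c_i:(\mathbf{H}^{\otimes 2}\otimes\mathbf{H}^*)^{\otimes i}\to(\bigwedge^{i+1}\mathbf{H})\otimes\mathbf{H}^*$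 be the contraction $$\bigotimes_{j=1}^i(a_j\otimes b_j\otimes d_j)\mapsto\Bigl(\prod_{j=2}^i d_j(b_{j-1})\Bigr)\,a_1\wedge a_2\wedge\cdots\wedge a_i\wedge b_i\otimes d_1 .$$ Write $c_i\iota_i$ also for the composite $c_i\circ\iota_i\circ j_i: H^A_i(\mathrm{IA}_\infty,\mathbb{Q})\to(\bigwedge^{i+1}\mathbf{H})\otimes\mathbf{H}^*$. Then for every $i\ge 1$: the space $H^A_i(\mathrm{IA}_\infty,\mathbb{Q})$ carries a linear action of $\mathrm{GL}(\infty,\mathbb{Q})$ for which $j_i$ is equivariant, and for this action $$c_i\iota_i: H^A_i(\mathrm{IA}_\infty,\mathbb{Q})\to\Bigl(\bigwedge^{i+1}\mathbf{H}\Bigr)\otimes\mathbf{H}^*$$ is a surjective $\mathrm{GL}(\infty,\mathbb{Q})$-homomorphism. In particular, $H^A_i(\mathrm{IA}_\infty,\mathbb{Q})$ and $H_i(\mathrm{IA}_\infty,\mathbb{Q})$ are infinite-dimensional over $\mathbb{Q}$ for every $i\ge 1$. -/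

import Mathlib

open scoped TensorProduct
open CategoryTheory

noncomputable section

namespace AlbaneseIA

/-! ### The spaces `H`, `H*` and the group `GL(∞, ℚ)` -/

/-- `H = ⋃ₙ H(n)`, the rational vector space with basis `e₀, e₁, e₂, …`, where `H(n)` is spanned
by the first `n` basis vectors (`eⱼ` is the class of the free generator `xⱼ`). -/
abbrev HInf : Type := ℕ →₀ ℚ

/-- The basis vector `eⱼ` of `H`. -/
def e (j : ℕ) : HInf := Finsupp.single j 1

/-- `H* = ⋃ₙ H(n)*`, where a linear form on `H(n)` is extended by zero to `eₙ, eₙ₊₁, …`: the linear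
forms on `H` that vanish on almost all basis vectors. -/
def HDual : Submodule ℚ (Module.Dual ℚ HInf) where
  carrier := {f | ∃ n, ∀ j, n ≤ j → f (e j) = 0}
  zero_mem' := ⟨0, fun _ _ => rfl⟩
  add_mem' := by
    rintro f g ⟨m, hm⟩ ⟨n, hn⟩
    refine ⟨max m n, fun j hj => ?_⟩
    rw [LinearMap.add_apply, hm j (le_trans (le_max_left _ _) hj),
      hn j (le_trans (le_max_right _ _) hj), add_zero]
  smul_mem' := by
    rintro c f ⟨m, hm⟩
    exact ⟨m, fun j hj => by rw [LinearMap.smul_apply, hm j hj, smul_zero]⟩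

/-- The dual basis vector `eⱼ*` of `H*`. -/
def eDual (j : ℕ) : HDual :=
  ⟨Finsupp.lapply j, j + 1, fun k hk => by
    have : k ≠ j := by omega
    simp [e, this]⟩

/-- `GL(∞, ℚ) = ⋃ₙ GL(n, ℚ)`, where `GL(n, ℚ) ⊂ GL(n + 1, ℚ)` via `A ↦ A ⊕ 1`: the linear
automorphisms of `H` whose matrix has the form `A ⊕ 1` for some square block `A`, that is, the
`j`-th column and the `j`-th row are those of the identity for all `j ≥ n`. -/
def GLInf : Subgroup (HInf ≃ₗ[ℚ] HInf) where
  carrier := {g | ∃ n, ∀ j, n ≤ j → g (e j) = e j ∧ ∀ v, g v j = v j}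
  one_mem' := ⟨0, fun _ _ => ⟨rfl, fun _ => rfl⟩⟩
  mul_mem' := by
    rintro g h ⟨m, hm⟩ ⟨n, hn⟩
    refine ⟨max m n, fun j hj => ?_⟩
    have h1 := hm j (le_trans (le_max_left _ _) hj)
    have h2 := hn j (le_trans (le_max_right _ _) hj)
    refine ⟨?_, fun v => ?_⟩
    · rw [LinearEquiv.mul_apply, h2.1, h1.1]
    · rw [LinearEquiv.mul_apply, h1.2, h2.2]
  inv_mem' := by
    rintro g ⟨n, hn⟩
    refine ⟨n, fun j hj => ⟨?_, fun v => ?_⟩⟩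
    · rw [← (hn j hj).1]
      exact (g.symm_apply_apply _).trans (hn j hj).1.symm
    · rw [← (hn j hj).2]
      exact congrArg (fun w : HInf => w j) (g.apply_symm_apply v)

/-- The standard representation of `GL(∞, ℚ)` on `H`. -/
def stdRep : Representation ℚ GLInf HInf where
  toFun g := (g : HInf ≃ₗ[ℚ] HInf).toLinearMap
  map_one' := rfl
  map_mul' _ _ := rfl

/-- The contragredient representation of `GL(∞, ℚ)` on `H*`, `(g · f)(v) = f (g⁻¹ v)`. -/
def dualRep : Representation ℚ GLInf HDual where
  toFun g := (stdRep.dual g).restrict (p := HDual) (q := HDual) (by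
    rintro f ⟨m, hm⟩
    obtain ⟨n, hn⟩ := (g⁻¹).2
    refine ⟨max m n, fun j hj => ?_⟩
    have h1 := (hn j (le_trans (le_max_right _ _) hj)).1
    have h2 := hm j (le_trans (le_max_left _ _) hj)
    change f (((g⁻¹ : GLInf) : HInf ≃ₗ[ℚ] HInf) (e j)) = 0
    rw [h1, h2])
  map_one' := by
    ext f : 2
    exact LinearMap.congr_fun (map_one stdRep.dual) f.1
  map_mul' g h := by
    ext f : 2
    exact LinearMap.congr_fun (map_mul stdRep.dual g h) f.1

/-- The `i`-th exterior power of a representation. -/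
def extRep {G V : Type} [Group G] [AddCommGroup V] [Module ℚ V] (ρ : Representation ℚ G V)
    (i : ℕ) : Representation ℚ G (⋀[ℚ]^i V) where
  toFun g := exteriorPower.map i (ρ g)
  map_one' := by
    rw [map_one]
    exact exteriorPower.map_id (R := ℚ) (M := V) (n := i)
  map_mul' g h := by
    rw [map_mul]
    refine exteriorPower.linearMap_ext (AlternatingMap.ext fun m => ?_)
    simp [Function.comp_def]

/-- `U = (⋀² H) ⊗ H*`. -/
abbrev UInf : Type := (⋀[ℚ]^2 HInf) ⊗[ℚ] HDual

/-- `GL(∞, ℚ)` acting diagonally on `(⋀ᵏ H) ⊗ H*`; for `k = 2` this is the action on `U`. -/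
def extDualRep (k : ℕ) : Representation ℚ GLInf ((⋀[ℚ]^k HInf) ⊗[ℚ] HDual) :=
  (extRep stdRep k).tprod dualRep

/-- `GL(∞, ℚ)` acting diagonally on `⋀ⁱ U`. -/
def extURep (i : ℕ) : Representation ℚ GLInf (⋀[ℚ]^i UInf) := extRep (extDualRep 2) i

/-! ### The groups `IA_n` and `IA_∞` -/

/-- The IA-automorphism group of the free group on `X`: the automorphisms that act trivially on
the abelianization. `IA_n` is `IAut (Fin n)`. -/
def IAut (X : Type) : Subgroup (MulAut (FreeGroup X)) where
  carrier := {φ | ∀ w, Abelianization.of (φ w) = Abelianization.of w}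
  one_mem' _ := rfl
  mul_mem' := fun {φ ψ} hφ hψ w => (hφ (ψ w)).trans (hψ w)
  inv_mem' := fun {φ} hφ w => by
    have h := hφ (φ⁻¹ w)
    rw [MulAut.apply_inv_self] at h
    exact h.symm

/-- Extension of an endomorphism of `F_n` to `F_∞ = ⟨x₀, x₁, …⟩`, fixing `xⱼ` for `j ≥ n`. -/
def extendHom (n : ℕ) (f : FreeGroup (Fin n) →* FreeGroup (Fin n)) :
    FreeGroup ℕ →* FreeGroup ℕ :=
  FreeGroup.lift fun j =>
    if h : j < n then FreeGroup.map Fin.val (f (FreeGroup.of ⟨j, h⟩)) else FreeGroup.of j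

theorem extendHom_map (n : ℕ) (f : FreeGroup (Fin n) →* FreeGroup (Fin n))
    (w : FreeGroup (Fin n)) :
    extendHom n f (FreeGroup.map Fin.val w) = FreeGroup.map Fin.val (f w) := by
  have h : (extendHom n f).comp (FreeGroup.map Fin.val) = (FreeGroup.map Fin.val).comp f := by
    ext j
    simp [extendHom]
  exact DFunLike.congr_fun h w

theorem extendHom_comp (n : ℕ) (f g : FreeGroup (Fin n) →* FreeGroup (Fin n)) :
    extendHom n (f.comp g) = (extendHom n f).comp (extendHom n g) := by
  ext j
  by_cases h : j < n
  · rw [MonoidHom.comp_apply]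
    have h1 : ∀ k : FreeGroup (Fin n) →* FreeGroup (Fin n), extendHom n k (FreeGroup.of j) =
        FreeGroup.map Fin.val (k (FreeGroup.of ⟨j, h⟩)) := fun k => by simp [extendHom, h]
    rw [h1, h1, extendHom_map, MonoidHom.comp_apply]
  · simp [extendHom, h]

theorem extendHom_id (n : ℕ) : extendHom n (MonoidHom.id _) = MonoidHom.id _ := by
  ext j
  by_cases h : j < n <;> simp [extendHom]

/-- The inclusion `Aut(F_n) → Aut(F_∞)`: `φ` is extended by `xⱼ ↦ xⱼ` for `j ≥ n`. -/
def stab (n : ℕ) : MulAut (FreeGroup (Fin n)) →* MulAut (FreeGroup ℕ) where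
  toFun φ := MonoidHom.toMulEquiv (extendHom n φ.toMonoidHom) (extendHom n φ.symm.toMonoidHom)
    (by
      rw [← extendHom_comp, ← extendHom_id n]
      congr 1
      ext w : 1
      simp)
    (by
      rw [← extendHom_comp, ← extendHom_id n]
      congr 1
      ext w : 1
      simp)
  map_one' := MulEquiv.ext fun w => DFunLike.congr_fun (extendHom_id n) w
  map_mul' φ ψ := MulEquiv.ext fun w =>
    DFunLike.congr_fun (extendHom_comp n φ.toMonoidHom ψ.toMonoidHom) w

/-- `IA_∞ = ⋃ₙ IA_n`, the direct limit of the groups `IA_n` along the inclusions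
`IA_n ⊂ IA_{n+1}` that extend an automorphism by `xₙ ↦ xₙ`, realized inside `Aut(F_∞)`. -/
def IAInf : Subgroup (MulAut (FreeGroup ℕ)) := ⨆ n, (IAut (Fin n)).map (stab n)

theorem stab_of_ge (n : ℕ) (φ : MulAut (FreeGroup (Fin n))) (j : ℕ) (hj : n ≤ j) :
    stab n φ (FreeGroup.of j) = FreeGroup.of j := by
  change extendHom n φ.toMonoidHom (FreeGroup.of j) = _
  simp [extendHom, hj]

/-- Restricting the stabilized automorphism to `F_n ⊂ F_∞` gives back the original one. -/
theorem stab_map (n : ℕ) (φ : MulAut (FreeGroup (Fin n))) (w : FreeGroup (Fin n)) :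
    stab n φ (FreeGroup.map Fin.val w) = FreeGroup.map Fin.val (φ w) :=
  extendHom_map n φ.toMonoidHom w

theorem IAInf_le_IAut : IAInf ≤ IAut ℕ := by
  refine iSup_le fun n => ?_
  rintro _ ⟨φ, hφ, rfl⟩
  have key : (Abelianization.of).comp (stab n φ).toMonoidHom = Abelianization.of := by
    ext j
    by_cases h : j < n
    · have h1 : (FreeGroup.of j : FreeGroup ℕ) =
          FreeGroup.map Fin.val (FreeGroup.of (⟨j, h⟩ : Fin n)) := by simp
      have h2 := congrArg (Abelianization.map (FreeGroup.map (Fin.val (n := n))))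
        (hφ (FreeGroup.of ⟨j, h⟩))
      rw [Abelianization.map_of, Abelianization.map_of] at h2
      change Abelianization.of (stab n φ (FreeGroup.of j)) = Abelianization.of (FreeGroup.of j)
      rw [h1, stab_map]
      exact h2
    · change Abelianization.of (stab n φ (FreeGroup.of j)) = _
      rw [stab_of_ge n φ j (by omega)]
  exact fun w => DFunLike.congr_fun key w

theorem IAInf_finitary (φ : MulAut (FreeGroup ℕ)) (hφ : φ ∈ IAInf) :
    ∃ n, ∀ j, n ≤ j → φ (FreeGroup.of j) = FreeGroup.of j := by
  induction hφ using Subgroup.iSup_induction' with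
  | hp n φ hφ =>
    obtain ⟨ψ, -, rfl⟩ := hφ
    exact ⟨n, stab_of_ge n ψ⟩
  | h1 => exact ⟨0, fun _ _ => rfl⟩
  | hmul φ ψ _ _ h1 h2 =>
    obtain ⟨m, hm⟩ := h1
    obtain ⟨n, hn⟩ := h2
    refine ⟨max m n, fun j hj => ?_⟩
    rw [MulAut.mul_apply, hn j (le_trans (le_max_right _ _) hj),
      hm j (le_trans (le_max_left _ _) hj)]

/-! ### The Johnson homomorphism -/

/-- The wedge product `a ∧ b` in `⋀² H`. -/
def wedge (a b : HInf) : ⋀[ℚ]^2 HInf := exteriorPower.ιMulti ℚ 2 ![a, b]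

theorem wedge_add_left (a a' b : HInf) : wedge (a + a') b = wedge a b + wedge a' b := by
  have u : ∀ x, Function.update ![a, b] 0 x = ![x, b] := fun x => by ext1 j; fin_cases j <;> rfl
  have h := (exteriorPower.ιMulti ℚ 2 (M := HInf)).map_update_add ![a, b] 0 a a'
  rwa [u, u, u] at h

theorem wedge_add_right (a b b' : HInf) : wedge a (b + b') = wedge a b + wedge a b' := by
  have u : ∀ x, Function.update ![a, b] 1 x = ![a, x] := fun x => by ext1 j; fin_cases j <;> rfl
  have h := (exteriorPower.ιMulti ℚ 2 (M := HInf)).map_update_add ![a, b] 1 b b'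
  rwa [u, u, u] at h

theorem wedge_smul_left (c : ℚ) (a b : HInf) : wedge (c • a) b = c • wedge a b := by
  have u : ∀ x, Function.update ![a, b] 0 x = ![x, b] := fun x => by ext1 j; fin_cases j <;> rfl
  have h := (exteriorPower.ιMulti ℚ 2 (M := HInf)).map_update_smul ![a, b] 0 c a
  rwa [u, u] at h

theorem wedge_smul_right (c : ℚ) (a b : HInf) : wedge a (c • b) = c • wedge a b := by
  have u : ∀ x, Function.update ![a, b] 1 x = ![a, x] := fun x => by ext1 j; fin_cases j <;> rfl
  have h := (exteriorPower.ιMulti ℚ 2 (M := HInf)).map_update_smul ![a, b] 1 c b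
  rwa [u, u] at h

theorem wedge_self (a : HInf) : wedge a a = 0 :=
  (exteriorPower.ιMulti ℚ 2 (M := HInf)).map_eq_zero_of_eq ![a, a] (i := 0) (j := 1) rfl
    (by decide)

/-- The group with underlying set `H × ⋀² H` and product
`(a, s)(b, t) = (a + b, s + t + ½ a ∧ b)`: the rational (Malcev) completion of the free nilpotent
group `F / [F, [F, F]]`, in exponential coordinates. -/
@[ext]
structure Nil2 where
  fst : HInf
  snd : ⋀[ℚ]^2 HInf

namespace Nil2

instance : Mul Nil2 := ⟨fun x y => ⟨x.fst + y.fst, x.snd + y.snd + (1 / 2 : ℚ) • wedge x.fst y.fst⟩⟩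
instance : One Nil2 := ⟨⟨0, 0⟩⟩
instance : Inv Nil2 := ⟨fun x => ⟨-x.fst, -x.snd⟩⟩

theorem mul_fst (x y : Nil2) : (x * y).fst = x.fst + y.fst := rfl
theorem mul_snd (x y : Nil2) :
    (x * y).snd = x.snd + y.snd + (1 / 2 : ℚ) • wedge x.fst y.fst := rfl
theorem one_fst : (1 : Nil2).fst = 0 := rfl
theorem one_snd : (1 : Nil2).snd = 0 := rfl
theorem inv_fst (x : Nil2) : (x⁻¹).fst = -x.fst := rfl
theorem inv_snd (x : Nil2) : (x⁻¹).snd = -x.snd := rfl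

theorem wedge_zero_left (b : HInf) : wedge 0 b = 0 := by
  have h := wedge_add_left 0 0 b
  rw [add_zero] at h
  exact left_eq_add.mp h

theorem wedge_zero_right (a : HInf) : wedge a 0 = 0 := by
  have h := wedge_add_right a 0 0
  rw [add_zero] at h
  exact left_eq_add.mp h

theorem wedge_neg_left (a b : HInf) : wedge (-a) b = -wedge a b := by
  rw [eq_neg_iff_add_eq_zero, ← wedge_add_left, neg_add_cancel, wedge_zero_left]

theorem wedge_neg_right (a b : HInf) : wedge a (-b) = -wedge a b := by
  rw [eq_neg_iff_add_eq_zero, ← wedge_add_right, neg_add_cancel, wedge_zero_right]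

theorem wedge_swap (a b : HInf) : wedge b a = -wedge a b := by
  have h := wedge_self (a + b)
  rw [wedge_add_left, wedge_add_right, wedge_add_right, wedge_self, wedge_self, zero_add,
    add_zero] at h
  exact (eq_neg_of_add_eq_zero_right h)

instance : Group Nil2 := Group.ofLeftAxioms
  (fun x y z => by
    ext1
    · simp only [mul_fst]; abel
    · simp only [mul_fst, mul_snd, wedge_add_left, wedge_add_right, smul_add]; abel)
  (fun x => by
    ext1
    · simp [mul_fst, one_fst]
    · simp [mul_snd, one_fst, one_snd, wedge_zero_left])
  (fun x => by
    ext1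
    · simp [mul_fst, one_fst, inv_fst]
    · simp [mul_snd, one_snd, inv_fst, inv_snd, wedge_neg_left, wedge_self])

end Nil2

/-- The homomorphism from `F_∞` to the class-two nilpotent group with `xⱼ ↦ (eⱼ, 0)`. -/
def toNil2 : FreeGroup ℕ →* Nil2 := FreeGroup.lift fun j => ⟨e j, 0⟩

/-- On the commutator subgroup, `toNil2` realizes the classical isomorphism from
`[F, F] / [F, [F, F]]` onto a lattice in `⋀² H`, sending the class of the commutator `[x, y] = x y x⁻¹ y⁻¹` to
the wedge product of the classes of `x` and `y`. -/
theorem toNil2_commutator (x y : FreeGroup ℕ) :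
    toNil2 (x * y * x⁻¹ * y⁻¹) = ⟨0, wedge (toNil2 x).fst (toNil2 y).fst⟩ := by
  simp only [map_mul, map_inv]
  ext1
  · simp only [Nil2.mul_fst, Nil2.inv_fst]; abel
  · simp only [Nil2.mul_fst, Nil2.mul_snd, Nil2.inv_fst, Nil2.inv_snd, wedge_add_left,
      Nil2.wedge_neg_left, Nil2.wedge_neg_right, wedge_self,
      Nil2.wedge_swap (toNil2 x).fst (toNil2 y).fst]
    module

/-- For `φ ∈ IA_∞`, the element `φ(xⱼ) xⱼ⁻¹` of the commutator subgroup, read in `⋀² H`. This is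
the value on `eⱼ` of the Johnson homomorphism at `φ`. -/
def johnsonCoeff (φ : IAInf) (j : ℕ) : ⋀[ℚ]^2 HInf :=
  (toNil2 ((φ : MulAut (FreeGroup ℕ)) (FreeGroup.of j) * (FreeGroup.of j)⁻¹)).snd

/-- The first coordinate of `toNil2` only depends on the class in the abelianization. -/
theorem toNil2_fst_congr {v w : FreeGroup ℕ}
    (h : Abelianization.of v = Abelianization.of w) : (toNil2 v).fst = (toNil2 w).fst := by
  let p : FreeGroup ℕ →* Multiplicative HInf :=
    { toFun := fun x => Multiplicative.ofAdd (toNil2 x).fst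
      map_one' := by rw [map_one]; rfl
      map_mul' := fun x y => by rw [map_mul]; rfl }
  have h2 := congrArg (Abelianization.lift p) h
  rw [Abelianization.lift_apply_of, Abelianization.lift_apply_of] at h2
  exact h2

/-- The difference between `toNil2 ∘ φ` and `toNil2`, as a homomorphism to `⋀² H`. -/
def johnsonDiff (φ : IAInf) : FreeGroup ℕ →* Multiplicative (⋀[ℚ]^2 HInf) where
  toFun w := Multiplicative.ofAdd
    ((toNil2 ((φ : MulAut (FreeGroup ℕ)) w)).snd - (toNil2 w).snd)
  map_one' := by simp
  map_mul' v w := by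
    rw [← ofAdd_add]
    congr 1
    have hv := toNil2_fst_congr (IAInf_le_IAut φ.2 v)
    have hw := toNil2_fst_congr (IAInf_le_IAut φ.2 w)
    simp only [map_mul, Nil2.mul_snd, hv, hw]
    abel

theorem johnsonCoeff_eq (φ : IAInf) (j : ℕ) :
    johnsonCoeff φ j = (johnsonDiff φ (FreeGroup.of j)).toAdd := by
  have h := toNil2_fst_congr (IAInf_le_IAut φ.2 (FreeGroup.of j))
  simp only [johnsonCoeff, map_mul, map_inv, Nil2.mul_snd, Nil2.inv_snd, Nil2.inv_fst, h,
    Nil2.wedge_neg_right, wedge_self, johnsonDiff, MonoidHom.coe_mk, OneHom.coe_mk, toAdd_ofAdd]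
  simp [sub_eq_add_neg]

theorem johnsonCoeff_mul (φ ψ : IAInf) (j : ℕ) :
    johnsonCoeff (φ * ψ) j = johnsonCoeff φ j + johnsonCoeff ψ j := by
  have h1 : johnsonDiff φ ((ψ : MulAut (FreeGroup ℕ)) (FreeGroup.of j)) =
      johnsonDiff φ (FreeGroup.of j) := by
    have h2 := congrArg (Abelianization.lift (johnsonDiff φ))
      (IAInf_le_IAut ψ.2 (FreeGroup.of j))
    rwa [Abelianization.lift_apply_of, Abelianization.lift_apply_of] at h2
  rw [johnsonCoeff_eq, johnsonCoeff_eq, johnsonCoeff_eq, ← h1]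
  simp [johnsonDiff]

theorem johnsonCoeff_finite (φ : IAInf) :
    (Function.support fun j => johnsonCoeff φ j ⊗ₜ[ℚ] eDual j).Finite := by
  obtain ⟨n, hn⟩ := IAInf_finitary φ φ.2
  refine (Set.finite_lt_nat n).subset fun j hj => ?_
  by_contra hlt
  apply hj
  simp [johnsonCoeff, hn j (not_lt.mp hlt), Nil2.one_snd]

/-- The Johnson homomorphism `τ : IA_∞ → U = (⋀² H) ⊗ H*`, `τ(φ) = ∑ⱼ [φ(xⱼ) xⱼ⁻¹] ⊗ eⱼ*`
(a finite sum). -/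
def johnson : IAInf →* Multiplicative UInf where
  toFun φ := Multiplicative.ofAdd (∑ᶠ j, johnsonCoeff φ j ⊗ₜ[ℚ] eDual j)
  map_one' := by
    simp [johnsonCoeff, Nil2.one_snd]
  map_mul' φ ψ := by
    rw [← ofAdd_add, ← finsum_add_distrib (johnsonCoeff_finite φ) (johnsonCoeff_finite ψ)]
    simp only [johnsonCoeff_mul, TensorProduct.add_tmul]

/-! ### Group homology and Albanese homology -/

/-- `H_i(G, ℚ)`, the group homology of `G` with trivial rational coefficients. -/
abbrev HQ (G : Type) [Group G] (i : ℕ) : ModuleCat ℚ := groupHomology (Rep.trivial ℚ G ℚ) i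

/-- The map `f_* : H_i(G, ℚ) → H_i(G', ℚ)` induced by a group homomorphism `f`. -/
def HQ.map {G G' : Type} [Group G] [Group G'] (f : G →* G') (i : ℕ) : HQ G i →ₗ[ℚ] HQ G' i :=
  (groupHomology.map (A := Rep.trivial ℚ G ℚ) (B := Rep.trivial ℚ G' ℚ) f
    (Rep.ofHom ⟨LinearMap.id, fun _ => rfl⟩) i).hom

/-- The Albanese homology `H^A_i(G, ℚ)`: the image of `H_i(G, ℚ) → H_i(G^ab, ℚ)`. -/
def AlbaneseHomology (G : Type) [Group G] (i : ℕ) : Submodule ℚ (HQ (Abelianization G) i) :=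
  LinearMap.range (HQ.map (Abelianization.of (G := G)) i)

/-- On inhomogeneous chains of a rational vector space `V` (as a group), the map
`[a₁|…|a_i] ↦ (1 / i!) a₁ ∧ … ∧ a_i`. -/
def chainToExterior (V : Type) [AddCommGroup V] [Module ℚ V] (i : ℕ) :
    ((Fin i → Multiplicative V) →₀ ℚ) →ₗ[ℚ] ⋀[ℚ]^i V :=
  Finsupp.lsum ℚ fun a => LinearMap.toSpanSingleton ℚ _
    ((1 / (i.factorial : ℚ)) • exteriorPower.ιMulti ℚ i fun j => (a j).toAdd)

/-- The cocycle identity: a multilinear map vanishes on boundaries of bar chains. -/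
theorem multilinear_boundary {V W : Type} [AddCommGroup V] [Module ℚ V] [AddCommGroup W]
    [Module ℚ W] (i : ℕ) (f : MultilinearMap ℚ (fun _ : Fin i => V) W) (a : Fin (i + 1) → V) :
    f (fun j => a j.succ) +
      ∑ j : Fin (i + 1), (-1 : ℚ) ^ ((j : ℕ) + 1) • f (Fin.contractNth j (· + ·) a) = 0 := by
  have key : ∀ j : Fin i, f (Fin.contractNth j.castSucc (· + ·) a) =
      f (a ∘ j.succ.succAbove) + f (a ∘ j.castSucc.succAbove) := by
    intro j
    have h0 : Fin.contractNth j.castSucc (· + ·) a =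
        Function.update (a ∘ j.castSucc.succAbove) j (a j.castSucc + a j.succ) := by
      ext1 k
      rcases lt_trichotomy k j with h | h | h
      · have h' : (k : ℕ) < (j : ℕ) := h
        rw [Function.update_of_ne h.ne, Function.comp_apply,
          Fin.succAbove_of_castSucc_lt _ _ (Fin.castSucc_lt_castSucc_iff.mpr h)]
        simp [Fin.contractNth, h']
      · subst h
        simp [Fin.contractNth]
      · have h' : (j : ℕ) < (k : ℕ) := h
        rw [Function.update_of_ne h.ne', Function.comp_apply,
          Fin.succAbove_of_le_castSucc _ _ (Fin.castSucc_le_castSucc_iff.mpr h.le)]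
        simp [Fin.contractNth, h'.not_gt, h'.ne']
    have h1 : Function.update (a ∘ j.castSucc.succAbove) j (a j.castSucc) =
        a ∘ j.succ.succAbove := by
      ext1 k
      rcases lt_trichotomy k j with h | h | h
      · rw [Function.update_of_ne h.ne, Function.comp_apply, Function.comp_apply,
          Fin.succAbove_of_castSucc_lt _ _ (Fin.castSucc_lt_castSucc_iff.mpr h),
          Fin.succAbove_of_castSucc_lt _ _ (Fin.castSucc_lt_succ_iff.mpr h.le)]
      · subst h
        simp
      · rw [Function.update_of_ne h.ne', Function.comp_apply, Function.comp_apply,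
          Fin.succAbove_of_le_castSucc _ _ (Fin.castSucc_le_castSucc_iff.mpr h.le),
          Fin.succAbove_of_le_castSucc _ _ (Fin.succ_le_castSucc_iff.mpr h)]
    have h2 : Function.update (a ∘ j.castSucc.succAbove) j (a j.succ) =
        a ∘ j.castSucc.succAbove := by
      have : a j.succ = (a ∘ j.castSucc.succAbove) j := by simp
      rw [this, Function.update_eq_self]
    rw [h0, f.map_update_add, h1, h2]
  have hlast : Fin.contractNth (Fin.last i) (· + ·) a = a ∘ (Fin.last i).succAbove := by
    ext1 k
    simp [Fin.contractNth]
  have hzero : (fun j => a j.succ) = a ∘ (0 : Fin (i + 1)).succAbove := by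
    ext1 k
    simp
  set G : Fin (i + 1) → W := fun j => (-1 : ℚ) ^ (j : ℕ) • f (a ∘ j.succAbove) with hG
  have hsum : ∀ j : Fin i, (-1 : ℚ) ^ ((j.castSucc : ℕ) + 1) •
      f (Fin.contractNth j.castSucc (· + ·) a) = G j.succ - G j.castSucc := by
    intro j
    rw [key, hG]
    simp only [Fin.val_succ, Fin.val_castSucc, pow_succ]
    module
  have h3 := Fin.sum_univ_succ G
  have h4 := Fin.sum_univ_castSucc G
  have h5 : G 0 = f (fun j => a j.succ) := by rw [hzero, hG]; simp
  have h6 : (-1 : ℚ) ^ ((Fin.last i : ℕ) + 1) • f (Fin.contractNth (Fin.last i) (· + ·) a) =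
      -G (Fin.last i) := by
    rw [hlast, hG]
    simp only [pow_succ]
    module
  rw [Fin.sum_univ_castSucc, Finset.sum_congr rfl fun j _ => hsum j, Finset.sum_sub_distrib, h6,
    ← h5]
  rw [h3] at h4
  rw [eq_sub_of_add_eq' h4]
  abel

theorem chainToExterior_single (V : Type) [AddCommGroup V] [Module ℚ V] (i : ℕ)
    (a : Fin i → Multiplicative V) (q : ℚ) :
    chainToExterior V i (Finsupp.single a q) =
      q • (1 / (i.factorial : ℚ)) • exteriorPower.ιMulti ℚ i (fun j => (a j).toAdd) := by
  simp [chainToExterior]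

theorem chainToExterior_boundary (V : Type) [AddCommGroup V] [Module ℚ V] (i : ℕ) :
    groupHomology.inhomogeneousChains.d (Rep.trivial ℚ (Multiplicative V) ℚ) i ≫
      ModuleCat.ofHom (chainToExterior V i) = 0 := by
  refine ModuleCat.hom_ext (Finsupp.lhom_ext fun a q => ?_)
  change chainToExterior V i
    (groupHomology.inhomogeneousChains.d (Rep.trivial ℚ (Multiplicative V) ℚ) i
      (Finsupp.single a q)) = 0
  rw [groupHomology.inhomogeneousChains.d_single, map_add, map_sum]
  have h := multilinear_boundary i (exteriorPower.ιMulti ℚ i (M := V)).toMultilinearMap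
    fun j => (a j).toAdd
  have hc : ∀ j : Fin (i + 1), (fun k => (Fin.contractNth j (· * ·) a k).toAdd) =
      Fin.contractNth j (· + ·) (fun j => (a j).toAdd) := fun j => by
    ext1 k
    simp only [Fin.contractNth]
    split_ifs <;> rfl
  have h1 : ∀ j : Fin (i + 1), chainToExterior V i ((-1 : ℚ) ^ ((j : ℕ) + 1) •
      Finsupp.single (Fin.contractNth j (· * ·) a) q) = (q * (1 / (i.factorial : ℚ))) •
        ((-1 : ℚ) ^ ((j : ℕ) + 1) • exteriorPower.ιMulti ℚ i
          (Fin.contractNth j (· + ·) (fun j => (a j).toAdd))) := fun j => by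
    rw [map_smul, chainToExterior_single, hc]
    module
  have h2 : chainToExterior V i (Finsupp.single (fun j => a j.succ) q) =
      (q * (1 / (i.factorial : ℚ))) • exteriorPower.ιMulti ℚ i fun j => (a j.succ).toAdd := by
    rw [chainToExterior_single, smul_smul]
  refine (congrArg₂ (· + ·) h2 (Finset.sum_congr rfl fun j _ => h1 j)).trans ?_
  rw [← Finset.smul_sum, ← smul_add]
  exact (congrArg _ h).trans (smul_zero _)

/-- The value on the class `∑_σ sgn(σ) [a_{σ(1)}|…|a_{σ(i)}]` of the torus defined by
`a₁, …, a_i` is `a₁ ∧ … ∧ a_i`. -/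
theorem chainToExterior_torus (V : Type) [AddCommGroup V] [Module ℚ V] (i : ℕ) (a : Fin i → V) :
    chainToExterior V i (∑ σ : Equiv.Perm (Fin i),
      Finsupp.single (fun j => Multiplicative.ofAdd (a (σ j))) ((Equiv.Perm.sign σ : ℤ) : ℚ)) =
      exteriorPower.ιMulti ℚ i a := by
  have h : ∀ σ : Equiv.Perm (Fin i), chainToExterior V i
      (Finsupp.single (fun j => Multiplicative.ofAdd (a (σ j))) ((Equiv.Perm.sign σ : ℤ) : ℚ)) =
      (1 / (i.factorial : ℚ)) • exteriorPower.ιMulti ℚ i a := fun σ => by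
    rw [chainToExterior_single]
    have h1 := (exteriorPower.ιMulti ℚ i (M := V)).map_perm a σ
    simp only [toAdd_ofAdd]
    rw [show (fun j => a (σ j)) = a ∘ σ from rfl, h1]
    rcases Int.units_eq_one_or (Equiv.Perm.sign σ) with hs | hs <;> simp [hs]
  rw [map_sum, Finset.sum_congr rfl fun σ _ => h σ, Finset.sum_const, Finset.card_univ,
    Fintype.card_perm, Fintype.card_fin, ← Nat.cast_smul_eq_nsmul ℚ, smul_smul,
    mul_one_div_cancel (by exact_mod_cast i.factorial_ne_zero), one_smul]

/-- The isomorphism `H_i(V, ℚ) → ⋀ⁱ V` for a rational vector space `V`. -/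
def homologyToExterior (V : Type) [AddCommGroup V] [Module ℚ V] (i : ℕ) :
    HQ (Multiplicative V) i →ₗ[ℚ] ⋀[ℚ]^i V :=
  ((groupHomology.inhomogeneousChains (Rep.trivial ℚ (Multiplicative V) ℚ)).homologyι i ≫
    (groupHomology.inhomogeneousChains (Rep.trivial ℚ (Multiplicative V) ℚ)).descOpcycles
      (ModuleCat.ofHom (chainToExterior V i)) (i + 1) (by simp) (by
        rw [groupHomology.inhomogeneousChains.d_def]
        exact chainToExterior_boundary V i)).hom

/-- For a homomorphism `f` from `G` to a rational vector space `V`, the induced map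
`H_i(G^ab, ℚ) → H_i(V, ℚ) = ⋀ⁱ V`. -/
def abToExterior {G V : Type} [Group G] [AddCommGroup V] [Module ℚ V]
    (f : G →* Multiplicative V) (i : ℕ) : HQ (Abelianization G) i →ₗ[ℚ] ⋀[ℚ]^i V :=
  homologyToExterior V i ∘ₗ HQ.map (Abelianization.lift f) i

/-- The map `H^A_i(IA_∞, ℚ) → ⋀ⁱ U` induced by the Johnson homomorphism. -/
def johnsonAlbanese (i : ℕ) : AlbaneseHomology IAInf i →ₗ[ℚ] ⋀[ℚ]^i UInf :=
  abToExterior johnson i ∘ₗ (AlbaneseHomology IAInf i).subtype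

/-! ### The maps `ι_i` and `c_i` -/

/-- `H^{⊗2} ⊗ H*`. -/
abbrev TInf : Type := (HInf ⊗[ℚ] HInf) ⊗[ℚ] HDual

/-- `V^{⊗i}`; in particular `M_i = (H^{⊗2} ⊗ H*)^{⊗i}` is `TPow TInf i`. -/
abbrev TPow (V : Type) [AddCommGroup V] [Module ℚ V] (i : ℕ) : Type := ⨂[ℚ] _ : Fin i, V

/-- The map `⋀² H → H ⊗ H`, `a ∧ b ↦ a ⊗ b - b ⊗ a`. -/
def antisym : ⋀[ℚ]^2 HInf →ₗ[ℚ] HInf ⊗[ℚ] HInf :=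
  exteriorPower.alternatingMapLinearEquiv
    { toFun := fun v => v 0 ⊗ₜ[ℚ] v 1 - v 1 ⊗ₜ[ℚ] v 0
      map_update_add' := by
        intro _ v j x y
        obtain rfl : ‹DecidableEq (Fin 2)› = instDecidableEqFin 2 := Subsingleton.elim _ _
        fin_cases j <;> simp [TensorProduct.add_tmul, TensorProduct.tmul_add] <;> abel
      map_update_smul' := by
        intro _ v j c x
        obtain rfl : ‹DecidableEq (Fin 2)› = instDecidableEqFin 2 := Subsingleton.elim _ _
        fin_cases j <;> simp [TensorProduct.smul_tmul', smul_sub]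
      map_eq_zero_of_eq' := by
        intro v j k h hjk
        have : v 0 = v 1 := by fin_cases j <;> fin_cases k <;> simp_all
        rw [this, sub_self] }

/-- `φ : U → H^{⊗2} ⊗ H*`, `(a ∧ b) ⊗ d ↦ (a ⊗ b - b ⊗ a) ⊗ d`. -/
def phi : UInf →ₗ[ℚ] TInf := TensorProduct.map antisym LinearMap.id

theorem phi_wedge (a b : HInf) (d : HDual) :
    phi (wedge a b ⊗ₜ d) = (a ⊗ₜ[ℚ] b - b ⊗ₜ[ℚ] a) ⊗ₜ[ℚ] d := by
  simp [phi, antisym, wedge]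

/-- For a linear map `f : V → T`, the map `⋀ⁱ V → T^{⊗i}`,
`u₁ ∧ … ∧ u_i ↦ ∑_σ sgn(σ) f(u_{σ(1)}) ⊗ … ⊗ f(u_{σ(i)})`. -/
def extToTPow {V T : Type} [AddCommGroup V] [Module ℚ V] [AddCommGroup T] [Module ℚ T]
    (f : V →ₗ[ℚ] T) (i : ℕ) : ⋀[ℚ]^i V →ₗ[ℚ] TPow T i :=
  exteriorPower.alternatingMapLinearEquiv
    (MultilinearMap.alternatization ((PiTensorProduct.tprod ℚ).compLinearMap fun _ => f))

theorem extToTPow_ιMulti {V T : Type} [AddCommGroup V] [Module ℚ V] [AddCommGroup T] [Module ℚ T]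
    (f : V →ₗ[ℚ] T) (i : ℕ) (u : Fin i → V) :
    extToTPow f i (exteriorPower.ιMulti ℚ i u) = ∑ σ : Equiv.Perm (Fin i),
      ((Equiv.Perm.sign σ : ℤ) : ℚ) • ⨂ₜ[ℚ] j, f (u (σ j)) := by
  simp only [extToTPow, exteriorPower.alternatingMapLinearEquiv_apply_ιMulti,
    MultilinearMap.alternatization_apply]
  refine Finset.sum_congr rfl fun σ _ => ?_
  rw [Int.cast_smul_eq_zsmul, Units.smul_def]
  rfl

/-- `ι_i : ⋀ⁱ U → M_i`,
`u₁ ∧ … ∧ u_i ↦ ∑_σ sgn(σ) φ(u_{σ(1)}) ⊗ … ⊗ φ(u_{σ(i)})`. -/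
def iota (i : ℕ) : ⋀[ℚ]^i UInf →ₗ[ℚ] TPow TInf i := extToTPow phi i

/-- Left multiplication `w ↦ a ∧ w` from `⋀ᵏ H` to `⋀^{k+1} H`. -/
def wedgeLeft (k : ℕ) : HInf →ₗ[ℚ] ⋀[ℚ]^k HInf →ₗ[ℚ] ⋀[ℚ]^(k + 1) HInf :=
  LinearMap.mk₂ ℚ
    (fun a w => ⟨ExteriorAlgebra.ι ℚ a * w, by
      change _ ∈ LinearMap.range (ExteriorAlgebra.ι ℚ (M := HInf)) ^ (k + 1)
      rw [pow_succ']
      exact Submodule.mul_mem_mul (LinearMap.mem_range_self _ a) w.2⟩)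
    (fun a b w => Subtype.ext (by simp [add_mul]))
    (fun c a w => Subtype.ext (by simp))
    (fun a v w => Subtype.ext (by simp [mul_add]))
    (fun c a w => Subtype.ext (by simp))

theorem wedgeLeft_ιMulti (k : ℕ) (a : HInf) (v : Fin k → HInf) :
    wedgeLeft k a (exteriorPower.ιMulti ℚ k v) =
      exteriorPower.ιMulti ℚ (k + 1) (Fin.cons a v) := by
  apply Subtype.ext
  simp only [wedgeLeft, LinearMap.mk₂_apply, exteriorPower.ιMulti_apply_coe,
    ExteriorAlgebra.ιMulti_apply, List.ofFn_succ, Fin.cons_zero, Fin.cons_succ, List.prod_cons]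

/-- `b ⊗ d ↦ (d' ↦ d'(b) d)`. -/
def pairEnd : HInf ⊗[ℚ] HDual →ₗ[ℚ] HDual →ₗ[ℚ] HDual :=
  TensorProduct.lift (LinearMap.mk₂ ℚ
    (fun b d => ((Module.Dual.eval ℚ HInf b).comp HDual.subtype).smulRight d)
    (fun _ _ _ => by ext; simp [add_mul])
    (fun _ _ _ => by ext; simp [mul_assoc])
    (fun _ _ _ => by ext; simp)
    (fun _ _ _ => by ext; simp [mul_left_comm]))

/-- One contraction step: `a ⊗ b ⊗ d` sends `w ⊗ d'` to `d'(b) (a ∧ w) ⊗ d`. -/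
def contractStep (k : ℕ) : TInf →ₗ[ℚ] (⋀[ℚ]^k HInf) ⊗[ℚ] HDual →ₗ[ℚ]
    (⋀[ℚ]^(k + 1) HInf) ⊗[ℚ] HDual :=
  TensorProduct.lift
    ((TensorProduct.mapBilinear (RingHom.id ℚ) _ _ _ _).compl₁₂ (wedgeLeft k) pairEnd) ∘ₗ
    (TensorProduct.assoc ℚ HInf HInf HDual).toLinearMap

theorem contractStep_tmul (k : ℕ) (a b : HInf) (d d' : HDual) (w : ⋀[ℚ]^k HInf) :
    contractStep k ((a ⊗ₜ[ℚ] b) ⊗ₜ[ℚ] d) (w ⊗ₜ[ℚ] d') =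
      (d' : Module.Dual ℚ HInf) b • wedgeLeft k a w ⊗ₜ[ℚ] d := by
  rw [← TensorProduct.tmul_smul]
  rfl

/-- The wedge product as a bilinear map. -/
def wedgeBilin : HInf →ₗ[ℚ] HInf →ₗ[ℚ] ⋀[ℚ]^2 HInf :=
  LinearMap.mk₂ ℚ wedge wedge_add_left wedge_smul_left wedge_add_right wedge_smul_right

/-- The multilinear map underlying `c_i`, built by contracting from the right. Its values on pure
tensors are given by `contractMulti_tmul`; the value for `i = 0` is irrelevant. -/
def contractMulti : (i : ℕ) →
    MultilinearMap ℚ (fun _ : Fin i => TInf) ((⋀[ℚ]^(i + 1) HInf) ⊗[ℚ] HDual)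
  | 0 => 0
  | 1 => MultilinearMap.ofSubsingleton ℚ TInf _ (0 : Fin 1)
      (TensorProduct.map (TensorProduct.lift wedgeBilin) LinearMap.id)
  | i + 2 => LinearMap.uncurryLeft
      { toFun := fun t => (contractStep (i + 2) t).compMultilinearMap (contractMulti (i + 1))
        map_add' := fun s t => by ext; simp
        map_smul' := fun c t => by ext; simp }

theorem contractMulti_succ (i : ℕ) (t : Fin (i + 2) → TInf) :
    contractMulti (i + 2) t = contractStep (i + 2) (t 0) (contractMulti (i + 1) (Fin.tail t)) :=
  rfl

/-- The formula for `c_i` on pure tensors: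
`⨂ⱼ (aⱼ ⊗ bⱼ ⊗ dⱼ) ↦ (∏_{j ≥ 2} dⱼ(b_{j-1})) a₁ ∧ … ∧ a_i ∧ b_i ⊗ d₁` (here `i = m + 1`). -/
theorem contractMulti_tmul (m : ℕ) (a b : Fin (m + 1) → HInf) (d : Fin (m + 1) → HDual) :
    contractMulti (m + 1) (fun j => (a j ⊗ₜ[ℚ] b j) ⊗ₜ[ℚ] d j) =
      (∏ j : Fin m, (d j.succ : Module.Dual ℚ HInf) (b j.castSucc)) •
        (exteriorPower.ιMulti ℚ (m + 2) (Fin.snoc a (b (Fin.last m)))) ⊗ₜ[ℚ] d 0 := by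
  induction m with
  | zero =>
    have h : (Fin.snoc a (b (Fin.last 0)) : Fin 2 → HInf) = ![a 0, b 0] := by
      ext1 j
      fin_cases j <;> rfl
    rw [h]
    simp [contractMulti, wedgeBilin, wedge]
  | succ m ih =>
    have h : (Fin.snoc a (b (Fin.last (m + 1))) : Fin (m + 3) → HInf) =
        Fin.cons (a 0) (Fin.snoc (Fin.tail a) (b (Fin.last (m + 1)))) := by
      rw [Fin.cons_snoc_eq_snoc_cons, Fin.cons_self_tail]
    have h2 := ih (fun j => a j.succ) (fun j => b j.succ) (fun j => d j.succ)
    rw [contractMulti_succ]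
    change contractStep (m + 2) ((a 0 ⊗ₜ[ℚ] b 0) ⊗ₜ[ℚ] d 0) (contractMulti (m + 1)
      fun j => (a j.succ ⊗ₜ[ℚ] b j.succ) ⊗ₜ[ℚ] d j.succ) = _
    rw [h2, h, ← wedgeLeft_ιMulti, Fin.prod_univ_succ, map_smul, mul_comm, mul_smul,
      contractStep_tmul, Fin.castSucc_zero]
    rfl

/-- The contraction `c_i : M_i → U_i = (⋀^{i+1} H) ⊗ H*`. -/
def contraction (i : ℕ) : TPow TInf i →ₗ[ℚ] (⋀[ℚ]^(i + 1) HInf) ⊗[ℚ] HDual :=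
  PiTensorProduct.lift (contractMulti i)

/-- The map `c_i ι_i : H^A_i(IA_∞, ℚ) → (⋀^{i+1} H) ⊗ H*`. -/
def cIota (i : ℕ) : AlbaneseHomology IAInf i →ₗ[ℚ] (⋀[ℚ]^(i + 1) HInf) ⊗[ℚ] HDual :=
  contraction i ∘ₗ iota i ∘ₗ johnsonAlbanese i

end AlbaneseIA

end

open AlbaneseIA

noncomputable section

namespace AlbaneseIA

/-! ### Induced maps on group homology -/

/-! The proof takes place in `⋀ⁱ U`, inside the image of `H_i(IA_∞, ℚ)`. By definition of Albanese
homology this is also the image of `H^A_i` (`range_abToExterior`), and it is computed on bar chains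
by `[g₁|…|g_i] ↦ (1/i!) τ(g₁) ∧ … ∧ τ(g_i)` (`homToExterior_π`).

Action. Conjugation by an automorphism of the free group acts on `IA_∞`, and the Johnson
homomorphism turns it into the action of the induced matrix (`johnson_conjIA`). Nielsen
automorphisms therefore show that the image is stable under the integral elementary matrices.
Rational ones follow because the action of `e_a ↦ e_a + t e_b` on any vector is polynomial in `t`,
and a polynomial with values in a subspace at all natural numbers stays in it. Diagonal matrices
follow from Whitehead's lemma, the determinant being compensated at a basis vector too far out to
affect the given vector (`stable_of_elem_one`). The action on the image is then lifted to `H^A_i`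
along a linear splitting, so injectivity of `j_i` is never needed.

Surjectivity. For distinct indices `k 0, …, k i`, conjugating `x_{k 0}, …, x_{k s}` by `x_{k (s+1)}`
gives `i` commuting elements of `IA_∞`, hence a torus class. The signs in `ι_i` and `c_i` match so
that all contributions to its image add up with positive coefficients. What remains is a positive
multiple of `e_{k 1} ∧ … ∧ e_{k i} ∧ e_{k 0} ⊗ e_{k 0}*` (`contraction_iota_conjTensor`), and the
tensors of this shape generate the target as a representation (`eq_top_of_stable`). Infinite
dimension is inherited from the target. -/

theorem HQ.map_comp {G G' G'' : Type} [Group G] [Group G'] [Group G''] (f : G →* G')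
    (g : G' →* G'') (i : ℕ) : HQ.map (g.comp f) i = HQ.map g i ∘ₗ HQ.map f i := by
  have h := groupHomology.map_comp (k := ℚ) (A := Rep.trivial ℚ G ℚ) (B := Rep.trivial ℚ G' ℚ)
    (C := Rep.trivial ℚ G'' ℚ) f g (Rep.ofHom ⟨LinearMap.id, fun _ => rfl⟩)
    (Rep.ofHom ⟨LinearMap.id, fun _ => rfl⟩) i
  exact congrArg ModuleCat.Hom.hom h

theorem homologyToExterior_π (V : Type) [AddCommGroup V] [Module ℚ V] (i : ℕ)
    (z : groupHomology.cycles (Rep.trivial ℚ (Multiplicative V) ℚ) i) :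
    homologyToExterior V i (groupHomology.π _ i z) =
      chainToExterior V i (groupHomology.iCycles _ i z) := by
  have h : groupHomology.π _ i ≫ ModuleCat.ofHom (homologyToExterior V i) =
      groupHomology.iCycles _ i ≫ ModuleCat.ofHom (chainToExterior V i) := by
    change _ ≫ ((groupHomology.inhomogeneousChains _).homologyι i ≫
      (groupHomology.inhomogeneousChains _).descOpcycles _ _ _ _) = _
    rw [← Category.assoc, HomologicalComplex.homology_π_ι, Category.assoc,
      HomologicalComplex.p_descOpcycles]
  exact LinearMap.congr_fun (congrArg ModuleCat.Hom.hom h) z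

/-- The map `H_i(G, ℚ) → ⋀ⁱ V` induced by a homomorphism from `G` to a rational vector space. -/
def homToExterior {G V : Type} [Group G] [AddCommGroup V] [Module ℚ V]
    (f : G →* Multiplicative V) (i : ℕ) : HQ G i →ₗ[ℚ] ⋀[ℚ]^i V :=
  homologyToExterior V i ∘ₗ HQ.map f i

/-- The map `[g₁|…|g_i] ↦ (1 / i!) f(g₁) ∧ … ∧ f(g_i)` on inhomogeneous chains of `G`. -/
def chainHomToExterior {G V : Type} [Group G] [AddCommGroup V] [Module ℚ V]
    (f : G →* Multiplicative V) (i : ℕ) : ((Fin i → G) →₀ ℚ) →ₗ[ℚ] ⋀[ℚ]^i V :=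
  chainToExterior V i ∘ₗ Finsupp.lmapDomain ℚ ℚ (f ∘ ·)

theorem chainHomToExterior_single {G V : Type} [Group G] [AddCommGroup V] [Module ℚ V]
    (f : G →* Multiplicative V) (i : ℕ) (g : Fin i → G) (q : ℚ) :
    chainHomToExterior f i (Finsupp.single g q) =
      q • (1 / (i.factorial : ℚ)) • exteriorPower.ιMulti ℚ i (fun j => (f (g j)).toAdd) := by
  simp [chainHomToExterior, Finsupp.mapDomain_single, chainToExterior_single]

/-- The bridge to explicit chains: naturality of `π` and of the inclusion of cycles reduces every
later identity to a check on a single bar symbol. -/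
theorem homToExterior_π {G V : Type} [Group G] [AddCommGroup V] [Module ℚ V]
    (f : G →* Multiplicative V) (i : ℕ) (z : groupHomology.cycles (Rep.trivial ℚ G ℚ) i) :
    homToExterior f i (groupHomology.π _ i z) =
      chainHomToExterior f i (groupHomology.iCycles _ i z) := by
  set φ : Rep.trivial ℚ G ℚ ⟶ Rep.res f (Rep.trivial ℚ (Multiplicative V) ℚ) :=
    Rep.ofHom ⟨LinearMap.id, fun _ => rfl⟩ with hφ
  have h1 : HQ.map f i (groupHomology.π _ i z) =
      groupHomology.π _ i (groupHomology.cyclesMap f φ i z) :=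
    LinearMap.congr_fun (congrArg ModuleCat.Hom.hom (groupHomology.π_map f φ i)) z
  have h2 : groupHomology.iCycles _ i (groupHomology.cyclesMap f φ i z) =
      (groupHomology.chainsMap f φ).f i (groupHomology.iCycles _ i z) :=
    LinearMap.congr_fun (congrArg ModuleCat.Hom.hom
      (HomologicalComplex.cyclesMap_i (groupHomology.chainsMap f φ) i)) z
  rw [homToExterior, LinearMap.comp_apply, h1, homologyToExterior_π, h2]
  have h3 : chainToExterior V i ∘ₗ ((groupHomology.chainsMap f φ).f i).hom =
      chainHomToExterior f i := by
    refine Finsupp.lhom_ext fun g q => ?_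
    have := groupHomology.chainsMap_f_single f φ i g q
    refine (congrArg (chainToExterior V i) this).trans ?_
    rw [chainHomToExterior_single]
    exact chainToExterior_single V i _ q
  exact LinearMap.congr_fun h3 _

theorem homToExterior_comp {G G' V : Type} [Group G] [Group G'] [AddCommGroup V] [Module ℚ V]
    (f : G' →* Multiplicative V) (c : G →* G') (i : ℕ) :
    homToExterior (f.comp c) i = homToExterior f i ∘ₗ HQ.map c i := by
  rw [homToExterior, HQ.map_comp]
  rfl

theorem homToExterior_map {G V V' : Type} [Group G] [AddCommGroup V] [Module ℚ V]
    [AddCommGroup V'] [Module ℚ V'] (f : G →* Multiplicative V) (L : V →ₗ[ℚ] V') (i : ℕ)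
    (x : HQ G i) :
    homToExterior ((AddMonoidHom.toMultiplicative L.toAddMonoidHom).comp f) i x =
      exteriorPower.map i L (homToExterior f i x) := by
  induction x using groupHomology_induction_on with
  | h z =>
    rw [homToExterior_π, homToExterior_π]
    have h : chainHomToExterior ((AddMonoidHom.toMultiplicative L.toAddMonoidHom).comp f) i =
        exteriorPower.map i L ∘ₗ chainHomToExterior f i := by
      refine Finsupp.lhom_ext fun g q => ?_
      rw [LinearMap.comp_apply, chainHomToExterior_single, chainHomToExterior_single, map_smul,
        map_smul, exteriorPower.map_apply_ιMulti]
      rfl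
    exact LinearMap.congr_fun h _

/-- If an endomorphism `c` of `G` corresponds to the linear endomorphism `L` of `V` under `f`, then
the image of the homology of `G` in `⋀ⁱ V` is stable under `L`. -/
theorem map_mem_range_homToExterior {G V : Type} [Group G] [AddCommGroup V] [Module ℚ V]
    (f : G →* Multiplicative V) (c : G →* G) (L : V →ₗ[ℚ] V)
    (h : ∀ x, (f (c x)).toAdd = L (f x).toAdd) (i : ℕ) {x : ⋀[ℚ]^i V}
    (hx : x ∈ LinearMap.range (homToExterior f i)) :
    exteriorPower.map i L x ∈ LinearMap.range (homToExterior f i) := by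
  obtain ⟨y, rfl⟩ := hx
  refine ⟨HQ.map c i y, ?_⟩
  have h2 : f.comp c = (AddMonoidHom.toMultiplicative L.toAddMonoidHom).comp f :=
    MonoidHom.ext fun x => congrArg Multiplicative.ofAdd (h x)
  rw [← homToExterior_map, ← LinearMap.comp_apply, ← homToExterior_comp, h2]

theorem abToExterior_map_of {G V : Type} [Group G] [AddCommGroup V] [Module ℚ V]
    (f : G →* Multiplicative V) (i : ℕ) (x : HQ G i) :
    abToExterior f i (HQ.map Abelianization.of i x) = homToExterior f i x := by
  have h : (Abelianization.lift f).comp Abelianization.of = f := MonoidHom.ext fun _ => by simp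
  have h2 := homToExterior_comp (Abelianization.lift f) Abelianization.of i
  rw [h] at h2
  rw [h2, LinearMap.comp_apply, abToExterior, LinearMap.comp_apply, homToExterior,
    LinearMap.comp_apply]

/-- `f` factors through the abelianization, and Albanese homology is by definition the image of
`H_i(G)` there. Cycles and endomorphisms of `G` itself can thus be used to study the image. -/
theorem range_abToExterior {G V : Type} [Group G] [AddCommGroup V] [Module ℚ V]
    (f : G →* Multiplicative V) (i : ℕ) :
    LinearMap.range (abToExterior f i ∘ₗ (AlbaneseHomology G i).subtype) =
      LinearMap.range (homToExterior f i) := by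
  have h : homToExterior f i = abToExterior f i ∘ₗ HQ.map (Abelianization.of (G := G)) i :=
    LinearMap.ext fun x => (abToExterior_map_of f i x).symm
  rw [h, LinearMap.range_comp, LinearMap.range_comp, Submodule.range_subtype]
  rfl

theorem range_johnsonAlbanese (i : ℕ) :
    LinearMap.range (johnsonAlbanese i) =
      LinearMap.range (homToExterior (G := IAInf) (V := UInf) johnson i) := by
  rw [← range_abToExterior, johnsonAlbanese]

/-! ### The homology class of a torus -/

/-- The chain `∑_σ sgn(σ) [g_{σ(1)}|…|g_{σ(i)}]`. -/
def torusChain {G : Type} {i : ℕ} (g : Fin i → G) : (Fin i → G) →₀ ℚ :=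
  ∑ σ : Equiv.Perm (Fin i), Finsupp.single (g ∘ σ) ((Equiv.Perm.sign σ : ℤ) : ℚ)

theorem chainHomToExterior_torusChain {G V : Type} [Group G] [AddCommGroup V] [Module ℚ V]
    (f : G →* Multiplicative V) (i : ℕ) (g : Fin i → G) :
    chainHomToExterior f i (torusChain g) =
      exteriorPower.ιMulti ℚ i (fun j => (f (g j)).toAdd) := by
  rw [← chainToExterior_torus, chainHomToExterior, LinearMap.comp_apply]
  congr 1
  simp only [torusChain, map_sum, Finsupp.lmapDomain_apply, Finsupp.mapDomain_single]
  rfl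

/-- The torus chain of pairwise commuting elements is a cycle. -/
theorem d_torusChain {G : Type} [Group G] {m : ℕ} (g : Fin (m + 1) → G)
    (hg : ∀ j k, Commute (g j) (g k)) :
    groupHomology.inhomogeneousChains.d (Rep.trivial ℚ G ℚ) m (torusChain g) = 0 := by
  have hd : ∀ σ : Equiv.Perm (Fin (m + 1)), groupHomology.inhomogeneousChains.d
      (Rep.trivial ℚ G ℚ) m (Finsupp.single (g ∘ σ) ((Equiv.Perm.sign σ : ℤ) : ℚ)) =
      (((Equiv.Perm.sign σ : ℤ) : ℚ) • Finsupp.single (fun j : Fin m => g (σ j.succ)) (1 : ℚ) +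
        (((Equiv.Perm.sign σ : ℤ) : ℚ) * (-1) ^ (m + 1)) •
          Finsupp.single (fun j : Fin m => g (σ j.castSucc)) (1 : ℚ)) +
      ∑ j : Fin m, (-1 : ℚ) ^ ((j : ℕ) + 1) • ((Equiv.Perm.sign σ : ℤ) : ℚ) •
        Finsupp.single (Fin.contractNth j.castSucc (· * ·) (g ∘ σ)) (1 : ℚ) := by
    intro σ
    rw [groupHomology.inhomogeneousChains.d_single, Fin.sum_univ_castSucc]
    have hl : Fin.contractNth (Fin.last m) (· * ·) (g ∘ σ) = fun j => g (σ j.castSucc) := by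
      ext1 k
      simp [Fin.contractNth]
    rw [hl]
    simp only [Finsupp.smul_single, smul_eq_mul, mul_one, Fin.val_last, Fin.val_castSucc,
      Function.comp_apply]
    rw [add_assoc, add_comm (Finsupp.single _ _) (Finset.sum _ _), mul_comm _ ((-1 : ℚ) ^ (m + 1))]
    rfl
  -- Inner faces cancel in pairs: composing `σ` with the transposition of `j` and `j + 1` reverses
  -- the sign, and the merged entry is unchanged because the two factors commute.
  have hmid : ∀ j : Fin m, ∑ σ : Equiv.Perm (Fin (m + 1)), ((Equiv.Perm.sign σ : ℤ) : ℚ) •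
      Finsupp.single (Fin.contractNth j.castSucc (· * ·) (g ∘ σ)) (1 : ℚ) = 0 := by
    intro j
    have hne : j.castSucc ≠ j.succ := (Fin.castSucc_lt_succ).ne
    refine Finset.sum_involution (fun σ _ => σ * Equiv.swap j.castSucc j.succ) ?_ ?_ ?_ ?_
    · intro σ _
      have : Fin.contractNth j.castSucc (· * ·)
          (g ∘ (σ * Equiv.swap j.castSucc j.succ : Equiv.Perm (Fin (m + 1)))) =
          Fin.contractNth j.castSucc (· * ·) (g ∘ σ) := by
        ext1 k
        rcases lt_trichotomy (k : ℕ) j with h | h | h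
        · have h1 : k.castSucc ≠ j.castSucc := fun e => by simp [Fin.ext_iff] at e; omega
          have h2 : k.castSucc ≠ j.succ := fun e => by simp [Fin.ext_iff] at e; omega
          simp [Fin.contractNth, h, Equiv.swap_apply_of_ne_of_ne h1 h2]
        · obtain rfl : k = j := Fin.ext h
          simp only [Fin.contractNth, Fin.val_castSucc, lt_irrefl, if_false, if_true,
            Function.comp_apply, Equiv.Perm.mul_apply, Equiv.swap_apply_left,
            Equiv.swap_apply_right]
          exact hg _ _
        · have h1 : k.succ ≠ j.castSucc := fun e => by simp [Fin.ext_iff] at e; omega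
          have h2 : k.succ ≠ j.succ := fun e => by simp [Fin.ext_iff] at e; omega
          simp [Fin.contractNth, h.not_gt, h.ne', Equiv.swap_apply_of_ne_of_ne h1 h2]
      rw [this, Equiv.Perm.sign_mul, Equiv.Perm.sign_swap hne]
      simp
    · intro σ _ _ h
      have h1 : Equiv.swap j.castSucc j.succ = 1 := mul_left_cancel (h.trans (mul_one σ).symm)
      exact hne (Equiv.swap_eq_one_iff.mp h1)
    · exact fun _ _ => Finset.mem_univ _
    · intro σ _
      rw [mul_assoc, Equiv.swap_mul_self, mul_one]
  have hends : ∑ σ : Equiv.Perm (Fin (m + 1)),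
      (((Equiv.Perm.sign σ : ℤ) : ℚ) • Finsupp.single (fun j : Fin m => g (σ j.succ)) (1 : ℚ) +
        (((Equiv.Perm.sign σ : ℤ) : ℚ) * (-1) ^ (m + 1)) •
          Finsupp.single (fun j : Fin m => g (σ j.castSucc)) (1 : ℚ)) = 0 := by
    -- Replacing `σ` by `σ` times the cyclic rotation turns the last face into the first one. The
    -- rotation has sign `(-1)^m`, which with the face sign `(-1)^(m+1)` leaves `-1`.
    rw [Finset.sum_add_distrib, ← Equiv.sum_comp (Equiv.mulRight (finRotate (m + 1)))
      (fun σ : Equiv.Perm (Fin (m + 1)) => (((Equiv.Perm.sign σ : ℤ) : ℚ) * (-1) ^ (m + 1)) •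
          Finsupp.single (fun j : Fin m => g (σ j.castSucc)) (1 : ℚ)), ← Finset.sum_add_distrib]
    refine Finset.sum_eq_zero fun σ _ => ?_
    have h1 : ∀ j : Fin m, finRotate (m + 1) j.castSucc = j.succ := fun j => by
      rw [finRotate_apply, Fin.coeSucc_eq_succ]
    have h2 : (-1 : ℚ) ^ m * (-1) ^ (m + 1) = -1 := by
      rw [← pow_add, show m + (m + 1) = 2 * m + 1 by ring, pow_succ, pow_mul]
      norm_num
    simp only [Equiv.coe_mulRight, Equiv.Perm.mul_apply, h1, Equiv.Perm.sign_mul, sign_finRotate]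
    rw [← add_smul]
    push_cast
    rw [mul_assoc, h2]
    simp
  rw [torusChain, map_sum, Finset.sum_congr rfl fun σ _ => hd σ, Finset.sum_add_distrib, hends,
    Finset.sum_comm]
  simp only [← Finset.smul_sum, hmid, smul_zero, Finset.sum_const_zero, add_zero]

/-- Pairwise commuting elements `g₁, …, g_i` of `G` define a class in `H_i(G, ℚ)` that is mapped
to `f(g₁) ∧ … ∧ f(g_i)` by every homomorphism `f` to a rational vector space. -/
theorem exists_homToExterior_eq_ιMulti {G V : Type} [Group G] [AddCommGroup V] [Module ℚ V]
    (f : G →* Multiplicative V) {m : ℕ} (g : Fin (m + 1) → G)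
    (hg : ∀ j k, Commute (g j) (g k)) :
    ∃ x, homToExterior f (m + 1) x =
      exteriorPower.ιMulti ℚ (m + 1) (fun j => (f (g j)).toAdd) := by
  have hd : (groupHomology.inhomogeneousChains (Rep.trivial ℚ G ℚ)).d (m + 1) m
      (torusChain g) = 0 := by
    rw [groupHomology.inhomogeneousChains.d_def]
    exact d_torusChain g hg
  refine ⟨groupHomology.π _ (m + 1) (groupHomology.cyclesMk (m + 1) m (by simp) _ hd), ?_⟩
  rw [homToExterior_π, groupHomology.iCycles_mk]
  exact chainHomToExterior_torusChain f (m + 1) g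

/-! ### Finitely supported automorphisms of the free group -/

/-- The automorphisms of `F_∞` that are extensions of automorphisms of `F_n`. -/
def finAut (n : ℕ) : Subgroup (MulAut (FreeGroup ℕ)) where
  -- Fixing `x_j` for `j ≥ n` does not force `F_n` to be preserved, as `x₀ ↦ x₀ x_n` shows. Asking
  -- for equality of subgroups, not inclusion, makes closure under inverses immediate.
  carrier := {φ | (∀ j, n ≤ j → φ (FreeGroup.of j) = FreeGroup.of j) ∧
    (FreeGroup.map (Fin.val (n := n))).range.map φ.toMonoidHom =
      (FreeGroup.map (Fin.val (n := n))).range}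
  one_mem' := ⟨fun _ _ => rfl, Subgroup.map_id _⟩
  mul_mem' := by
    rintro φ ψ ⟨h1, h2⟩ ⟨h3, h4⟩
    refine ⟨fun j hj => by rw [MulAut.mul_apply, h3 j hj, h1 j hj], ?_⟩
    have h : (φ * ψ).toMonoidHom = φ.toMonoidHom.comp ψ.toMonoidHom := rfl
    rw [h, ← Subgroup.map_map, h4, h2]
  inv_mem' := by
    rintro φ ⟨h1, h2⟩
    refine ⟨fun j hj => ?_, ?_⟩
    · conv_lhs => rw [← h1 j hj]
      exact MulAut.inv_apply_self _ _ _
    · conv_lhs => rw [← h2]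
      rw [Subgroup.map_map]
      have h : (φ⁻¹).toMonoidHom.comp φ.toMonoidHom = MonoidHom.id _ :=
        MonoidHom.ext fun w => MulAut.inv_apply_self _ φ w
      rw [h, Subgroup.map_id]

theorem range_map_val_eq_closure (n : ℕ) : (FreeGroup.map (Fin.val (n := n))).range =
    Subgroup.closure (FreeGroup.of '' {j | j < n}) := by
  rw [MonoidHom.range_eq_map, ← FreeGroup.closure_range_of, MonoidHom.map_closure]
  congr 1
  ext w
  constructor
  · rintro ⟨_, ⟨j, rfl⟩, rfl⟩
    exact ⟨j, j.2, by simp⟩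
  · rintro ⟨j, hj, rfl⟩
    exact ⟨FreeGroup.of ⟨j, hj⟩, ⟨_, rfl⟩, by simp⟩

theorem of_mem_range_map_val {n j : ℕ} (hj : j < n) :
    FreeGroup.of j ∈ (FreeGroup.map (Fin.val (n := n))).range :=
  ⟨FreeGroup.of ⟨j, hj⟩, by simp⟩

theorem map_range_map_val_le {n : ℕ} {f : FreeGroup ℕ →* FreeGroup ℕ}
    (h : ∀ j < n, f (FreeGroup.of j) ∈ (FreeGroup.map (Fin.val (n := n))).range) :
    (FreeGroup.map (Fin.val (n := n))).range.map f ≤ (FreeGroup.map (Fin.val (n := n))).range := by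
  rw [Subgroup.map_le_iff_le_comap]
  conv_lhs => rw [range_map_val_eq_closure]
  rw [Subgroup.closure_le]
  rintro _ ⟨j, hj, rfl⟩
  exact h j hj

theorem mem_finAut_of_forall {n : ℕ} {φ : MulAut (FreeGroup ℕ)}
    (h : ∀ j, n ≤ j → φ (FreeGroup.of j) = FreeGroup.of j)
    (h1 : ∀ j < n, φ (FreeGroup.of j) ∈ (FreeGroup.map (Fin.val (n := n))).range)
    (h2 : ∀ j < n, φ⁻¹ (FreeGroup.of j) ∈ (FreeGroup.map (Fin.val (n := n))).range) :
    φ ∈ finAut n := by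
  refine ⟨h, le_antisymm (map_range_map_val_le h1) ?_⟩
  intro w hw
  refine ⟨φ⁻¹ w, map_range_map_val_le (f := (φ⁻¹).toMonoidHom) h2 ⟨w, hw, rfl⟩, ?_⟩
  exact MulAut.apply_inv_self _ φ w

theorem finAut_mono {m n : ℕ} (hmn : m ≤ n) : finAut m ≤ finAut n := by
  intro φ hφ
  have key : ∀ ψ ∈ finAut m, ∀ j < n,
      ψ (FreeGroup.of j) ∈ (FreeGroup.map (Fin.val (n := n))).range := by
    rintro ψ ⟨h1, h2⟩ j hj
    by_cases hjm : j < m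
    · have h3 : ψ (FreeGroup.of j) ∈ (FreeGroup.map (Fin.val (n := m))).range := by
        rw [← h2]
        exact ⟨_, of_mem_range_map_val hjm, rfl⟩
      rw [range_map_val_eq_closure] at h3 ⊢
      exact Subgroup.closure_mono (Set.image_mono fun k hk => lt_of_lt_of_le hk hmn) h3
    · rw [h1 j (not_lt.mp hjm)]
      exact of_mem_range_map_val hj
  exact mem_finAut_of_forall (fun j hj => hφ.1 j (hmn.trans hj)) (key φ hφ)
    (key _ (inv_mem hφ))

theorem stab_mem_finAut (n : ℕ) (φ : MulAut (FreeGroup (Fin n))) : stab n φ ∈ finAut n := by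
  refine mem_finAut_of_forall (stab_of_ge n φ) (fun j hj => ?_) (fun j hj => ?_)
  · have h : (FreeGroup.of j : FreeGroup ℕ) = FreeGroup.map Fin.val
      (FreeGroup.of (⟨j, hj⟩ : Fin n)) := by simp
    rw [h, stab_map]
    exact ⟨_, rfl⟩
  · have h : (FreeGroup.of j : FreeGroup ℕ) = FreeGroup.map Fin.val
      (FreeGroup.of (⟨j, hj⟩ : Fin n)) := by simp
    rw [← map_inv, h, stab_map]
    exact ⟨_, rfl⟩

/-- The retraction `F_∞ → F_n` killing `xⱼ` for `j ≥ n`. -/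
def freeRetract (n : ℕ) : FreeGroup ℕ →* FreeGroup (Fin n) :=
  FreeGroup.lift fun j => if h : j < n then FreeGroup.of ⟨j, h⟩ else 1

theorem freeRetract_map (n : ℕ) (w : FreeGroup (Fin n)) :
    freeRetract n (FreeGroup.map Fin.val w) = w := by
  have h : (freeRetract n).comp (FreeGroup.map Fin.val) = MonoidHom.id _ := by
    ext j
    simp [freeRetract]
  exact DFunLike.congr_fun h w

theorem map_freeRetract {n : ℕ} {w : FreeGroup ℕ}
    (hw : w ∈ (FreeGroup.map (Fin.val (n := n))).range) :
    FreeGroup.map Fin.val (freeRetract n w) = w := by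
  obtain ⟨v, rfl⟩ := hw
  rw [freeRetract_map]

theorem apply_map_mem {n : ℕ} {φ : MulAut (FreeGroup ℕ)} (hφ : φ ∈ finAut n)
    (w : FreeGroup (Fin n)) :
    φ (FreeGroup.map Fin.val w) ∈ (FreeGroup.map (Fin.val (n := n))).range := by
  rw [← hφ.2]
  exact ⟨_, ⟨w, rfl⟩, rfl⟩

/-- The restriction to `F_n` of an automorphism in `finAut n`. -/
def restrictAut {n : ℕ} {φ : MulAut (FreeGroup ℕ)} (hφ : φ ∈ finAut n) :
    MulAut (FreeGroup (Fin n)) :=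
  MonoidHom.toMulEquiv ((freeRetract n).comp (φ.toMonoidHom.comp (FreeGroup.map Fin.val)))
    ((freeRetract n).comp ((φ⁻¹).toMonoidHom.comp (FreeGroup.map Fin.val)))
    (MonoidHom.ext fun w => by
      change freeRetract n (φ⁻¹ (FreeGroup.map Fin.val (freeRetract n
        (φ (FreeGroup.map Fin.val w))))) = w
      rw [map_freeRetract (apply_map_mem hφ w), MulAut.inv_apply_self, freeRetract_map])
    (MonoidHom.ext fun w => by
      change freeRetract n (φ (FreeGroup.map Fin.val (freeRetract n
        (φ⁻¹ (FreeGroup.map Fin.val w))))) = w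
      rw [map_freeRetract (apply_map_mem (inv_mem hφ) w), MulAut.apply_inv_self, freeRetract_map])

theorem restrictAut_apply {n : ℕ} {φ : MulAut (FreeGroup ℕ)} (hφ : φ ∈ finAut n)
    (w : FreeGroup (Fin n)) :
    restrictAut hφ w = freeRetract n (φ (FreeGroup.map Fin.val w)) := rfl

theorem MulAut_ext_of {φ ψ : MulAut (FreeGroup ℕ)}
    (h : ∀ j, φ (FreeGroup.of j) = ψ (FreeGroup.of j)) : φ = ψ := by
  have : φ.toMonoidHom = ψ.toMonoidHom := FreeGroup.ext_hom _ _ h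
  exact MulEquiv.ext fun w => DFunLike.congr_fun this w

theorem stab_restrictAut {n : ℕ} {φ : MulAut (FreeGroup ℕ)} (hφ : φ ∈ finAut n) :
    stab n (restrictAut hφ) = φ := by
  refine MulAut_ext_of fun j => ?_
  by_cases hj : j < n
  · have h : (FreeGroup.of j : FreeGroup ℕ) = FreeGroup.map Fin.val
      (FreeGroup.of (⟨j, hj⟩ : Fin n)) := by simp
    rw [h, stab_map, restrictAut_apply, map_freeRetract (apply_map_mem hφ _)]
  · rw [stab_of_ge n _ j (not_lt.mp hj), hφ.1 j (not_lt.mp hj)]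

/-- The retraction `F_∞ → F_n` passes to abelianizations, so triviality on the abelianization of
`F_∞` descends to that of `F_n`. This is the practical criterion for membership in the supremum that
defines `IA_∞`. -/
theorem mem_IAInf_of_mem_finAut {n : ℕ} {φ : MulAut (FreeGroup ℕ)} (hφ : φ ∈ finAut n)
    (h : φ ∈ IAut ℕ) : φ ∈ IAInf := by
  refine Subgroup.mem_iSup_of_mem n ⟨restrictAut hφ, fun w => ?_, stab_restrictAut hφ⟩
  rw [restrictAut_apply]
  have h2 := congrArg (Abelianization.map (freeRetract n)) (h (FreeGroup.map Fin.val w))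
  rwa [Abelianization.map_of, Abelianization.map_of, freeRetract_map] at h2

theorem exists_mem_finAut {φ : MulAut (FreeGroup ℕ)} (hφ : φ ∈ IAInf) : ∃ n, φ ∈ finAut n := by
  induction hφ using Subgroup.iSup_induction' with
  | hp n φ hφ =>
    obtain ⟨ψ, -, rfl⟩ := hφ
    exact ⟨n, stab_mem_finAut n ψ⟩
  | h1 => exact ⟨0, one_mem _⟩
  | hmul φ ψ _ _ h1 h2 =>
    obtain ⟨m, hm⟩ := h1
    obtain ⟨n, hn⟩ := h2
    exact ⟨max m n, mul_mem (finAut_mono (le_max_left _ _) hm) (finAut_mono (le_max_right _ _) hn)⟩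

theorem IAut_conj_mem (ν : MulAut (FreeGroup ℕ)) {φ : MulAut (FreeGroup ℕ)} (hφ : φ ∈ IAut ℕ) :
    ν * φ * ν⁻¹ ∈ IAut ℕ := by
  intro w
  have h := congrArg (Abelianization.map ν.toMonoidHom) (hφ (ν⁻¹ w))
  rw [Abelianization.map_of, Abelianization.map_of] at h
  refine Eq.trans h ?_
  exact congrArg _ (MulAut.apply_inv_self _ ν w)

/-- Both automorphisms live on a common `F_m`, and acting trivially on the abelianization is a
normal condition; `ν` itself need not lie in `IA_∞`. -/
theorem IAInf_conj_mem {n : ℕ} {ν : MulAut (FreeGroup ℕ)} (hν : ν ∈ finAut n)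
    {φ : MulAut (FreeGroup ℕ)} (hφ : φ ∈ IAInf) : ν * φ * ν⁻¹ ∈ IAInf := by
  obtain ⟨m, hm⟩ := exists_mem_finAut hφ
  have h1 := finAut_mono (le_max_left m n) hm
  have h2 := finAut_mono (le_max_right m n) hν
  exact mem_IAInf_of_mem_finAut (mul_mem (mul_mem h2 h1) (inv_mem h2))
    (IAut_conj_mem ν (IAInf_le_IAut hφ))

/-- Conjugation by a finitely supported automorphism, as an endomorphism of `IA_∞`. -/
def conjIA {n : ℕ} {ν : MulAut (FreeGroup ℕ)} (hν : ν ∈ finAut n) : IAInf →* IAInf :=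
  ((MulAut.conj ν).toMonoidHom.comp IAInf.subtype).codRestrict IAInf
    fun φ => IAInf_conj_mem hν φ.2

theorem conjIA_coe {n : ℕ} {ν : MulAut (FreeGroup ℕ)} (hν : ν ∈ finAut n) (φ : IAInf) :
    (conjIA hν φ : MulAut (FreeGroup ℕ)) = ν * φ * ν⁻¹ := rfl

/-! ### Equivariance of the Johnson homomorphism -/

theorem eDual_apply (j : ℕ) (v : HInf) : (eDual j : Module.Dual ℚ HInf) v = v j := rfl

theorem eDual_e (j k : ℕ) : (eDual j : Module.Dual ℚ HInf) (e k) = if k = j then 1 else 0 := by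
  rw [eDual_apply, e, Finsupp.single_apply]

theorem HInf_ext {V : Type} [AddCommMonoid V] [Module ℚ V] {f g : HInf →ₗ[ℚ] V}
    (h : ∀ j, f (e j) = g (e j)) : f = g :=
  Finsupp.lhom_ext' fun j => LinearMap.ext_ring (h j)

theorem HDual_eq_sum (d : HDual) :
    ∃ n, ∀ m ≥ n, d = ∑ j ∈ Finset.range m, (d : Module.Dual ℚ HInf) (e j) • eDual j := by
  obtain ⟨n, hn⟩ := d.2
  refine ⟨n, fun m hm => Subtype.ext (HInf_ext fun k => ?_)⟩
  simp only [Submodule.coe_sum, Submodule.coe_smul, LinearMap.sum_apply, LinearMap.smul_apply,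
    eDual_e, smul_eq_mul, mul_ite, mul_one, mul_zero, Finset.sum_ite_eq, Finset.mem_range]
  split_ifs with h
  · rfl
  · exact hn k (by omega)

/-- The evaluation `W ⊗ H* → Hom(H, W)`. -/
def evalHom (W : Type) [AddCommGroup W] [Module ℚ W] : W ⊗[ℚ] HDual →ₗ[ℚ] HInf →ₗ[ℚ] W :=
  dualTensorHom ℚ HInf W ∘ₗ (TensorProduct.comm ℚ _ _).toLinearMap ∘ₗ
    TensorProduct.map LinearMap.id HDual.subtype

theorem evalHom_tmul {W : Type} [AddCommGroup W] [Module ℚ W] (w : W) (d : HDual) (v : HInf) :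
    evalHom W (w ⊗ₜ d) v = (d : Module.Dual ℚ HInf) v • w := by
  simp [evalHom]

/-- A tensor is recovered from its values on the basis, since forms in `H*` have finite support. The
bound is stated for all large `m` so that two summands can share one. -/
theorem eq_sum_evalHom {W : Type} [AddCommGroup W] [Module ℚ W] (u : W ⊗[ℚ] HDual) :
    ∃ n, ∀ m ≥ n, u = ∑ j ∈ Finset.range m, evalHom W u (e j) ⊗ₜ[ℚ] eDual j := by
  induction u using TensorProduct.induction_on with
  | zero => exact ⟨0, fun _ _ => by simp⟩
  | tmul w d =>
    obtain ⟨n, hn⟩ := HDual_eq_sum d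
    refine ⟨n, fun m hm => ?_⟩
    conv_lhs => rw [hn m hm]
    simp only [evalHom_tmul, TensorProduct.tmul_sum, TensorProduct.tmul_smul,
      TensorProduct.smul_tmul']
  | add x y hx hy =>
    obtain ⟨m, hm⟩ := hx
    obtain ⟨n, hn⟩ := hy
    refine ⟨max m n, fun k hk => ?_⟩
    conv_lhs => rw [hm k (by omega), hn k (by omega)]
    simp only [map_add, LinearMap.add_apply, TensorProduct.add_tmul, Finset.sum_add_distrib]

/-- Used to prove identities in `U` by evaluating on `H`, where the Johnson homomorphism reads off
words directly. -/
theorem evalHom_injective (W : Type) [AddCommGroup W] [Module ℚ W] :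
    Function.Injective (evalHom W) := by
  rw [← LinearMap.ker_eq_bot, LinearMap.ker_eq_bot']
  intro u hu
  obtain ⟨n, hn⟩ := eq_sum_evalHom u
  rw [hn n le_rfl]
  simp [hu]

theorem evalHom_johnson_e (φ : IAInf) (j : ℕ) :
    evalHom _ (johnson φ).toAdd (e j) = johnsonCoeff φ j := by
  change evalHom (⋀[ℚ]^2 HInf) (∑ᶠ k, johnsonCoeff φ k ⊗ₜ[ℚ] eDual k) (e j) = _
  have h := AddMonoidHom.map_finsum ((LinearMap.applyₗ (e j) ∘ₗ
    evalHom (⋀[ℚ]^2 HInf)).toAddMonoidHom) (johnsonCoeff_finite φ)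
  refine h.trans ?_
  have h2 : ∀ k, (LinearMap.applyₗ (e j) ∘ₗ evalHom (⋀[ℚ]^2 HInf)).toAddMonoidHom
      (johnsonCoeff φ k ⊗ₜ[ℚ] eDual k) = if j = k then johnsonCoeff φ k else 0 := by
    intro k
    change evalHom (⋀[ℚ]^2 HInf) (johnsonCoeff φ k ⊗ₜ[ℚ] eDual k) (e j) = _
    rw [evalHom_tmul, eDual_e]
    split_ifs <;> simp
  simp only [h2]
  rw [finsum_eq_single _ j fun k hk => if_neg hk.symm, if_pos rfl]

/-- Both sides are homomorphisms in `w` that agree on the generators. This frees the Johnson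
homomorphism from the chosen basis, as is needed to evaluate it at `ν(x_j)`. -/
theorem evalHom_johnson (φ : IAInf) (w : FreeGroup ℕ) :
    evalHom _ (johnson φ).toAdd (toNil2 w).fst = (johnsonDiff φ w).toAdd := by
  let p : FreeGroup ℕ →* Multiplicative (⋀[ℚ]^2 HInf) :=
    { toFun := fun w => Multiplicative.ofAdd (evalHom _ (johnson φ).toAdd (toNil2 w).fst)
      map_one' := by rw [map_one, Nil2.one_fst, map_zero]; rfl
      map_mul' := fun x y => by rw [map_mul, Nil2.mul_fst, map_add]; rfl }
  have h : p = johnsonDiff φ := by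
    refine FreeGroup.ext_hom _ _ fun j => ?_
    have h1 : (toNil2 (FreeGroup.of j)).fst = e j := by simp [toNil2]
    change Multiplicative.ofAdd (evalHom _ (johnson φ).toAdd (toNil2 (FreeGroup.of j)).fst) = _
    rw [h1, evalHom_johnson_e, johnsonCoeff_eq]
    rfl
  exact congrArg Multiplicative.toAdd (DFunLike.congr_fun h w)

theorem dualRep_apply (g : GLInf) (d : HDual) (v : HInf) :
    (dualRep g d : Module.Dual ℚ HInf) v = (d : Module.Dual ℚ HInf) (stdRep g⁻¹ v) := rfl

theorem extRep_ιMulti {G V : Type} [Group G] [AddCommGroup V] [Module ℚ V]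
    (ρ : Representation ℚ G V) {i : ℕ} (g : G) (u : Fin i → V) :
    extRep ρ i g (exteriorPower.ιMulti ℚ i u) = exteriorPower.ιMulti ℚ i fun j => ρ g (u j) :=
  exteriorPower.map_apply_ιMulti _ _

theorem extRep_wedge (g : GLInf) (a b : HInf) :
    extRep stdRep 2 g (wedge a b) = wedge (stdRep g a) (stdRep g b) := by
  rw [wedge, extRep_ιMulti, wedge]
  congr 1
  ext1 j
  fin_cases j <;> rfl

theorem extDualRep_tmul (k : ℕ) (g : GLInf) (w : ⋀[ℚ]^k HInf) (d : HDual) :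
    extDualRep k g (w ⊗ₜ d) = extRep stdRep k g w ⊗ₜ dualRep g d := rfl

theorem evalHom_extDualRep (k : ℕ) (g : GLInf) (u : (⋀[ℚ]^k HInf) ⊗[ℚ] HDual) (v : HInf) :
    evalHom _ (extDualRep k g u) v = extRep stdRep k g (evalHom _ u (stdRep g⁻¹ v)) := by
  induction u using TensorProduct.induction_on with
  | zero => simp
  | tmul w d => rw [extDualRep_tmul, evalHom_tmul, evalHom_tmul, map_smul, dualRep_apply]
  | add x y hx hy => simp only [map_add, LinearMap.add_apply, hx, hy]

/-- If `ν ∈ Aut(F_∞)` induces `g ∈ GL(∞, ℚ)` on the abelianization, then conjugation by `ν`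
corresponds to the action of `g` under the Johnson homomorphism. -/
theorem johnson_conjIA {n : ℕ} {ν : MulAut (FreeGroup ℕ)} (hν : ν ∈ finAut n) (g : GLInf)
    (h : ∀ j, (toNil2 (ν (FreeGroup.of j))).fst = stdRep g (e j)) (φ : IAInf) :
    (johnson (conjIA hν φ)).toAdd = extDualRep 2 g (johnson φ).toAdd := by
  have hfst : ∀ w, (toNil2 (ν w)).fst = stdRep g (toNil2 w).fst := by
    let p : FreeGroup ℕ →* Multiplicative HInf :=
      { toFun := fun w => Multiplicative.ofAdd (toNil2 (ν w)).fst
        map_one' := by rw [map_one, map_one]; rfl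
        map_mul' := fun x y => by rw [map_mul, map_mul]; rfl }
    let q : FreeGroup ℕ →* Multiplicative HInf :=
      { toFun := fun w => Multiplicative.ofAdd (stdRep g (toNil2 w).fst)
        map_one' := by rw [map_one, Nil2.one_fst, map_zero]; rfl
        map_mul' := fun x y => by rw [map_mul, Nil2.mul_fst, map_add]; rfl }
    have hpq : p = q := by
      refine FreeGroup.ext_hom _ _ fun j => ?_
      have h1 : (toNil2 (FreeGroup.of j)).fst = e j := by simp [toNil2]
      change Multiplicative.ofAdd (toNil2 (ν (FreeGroup.of j))).fst =
        Multiplicative.ofAdd (stdRep g (toNil2 (FreeGroup.of j)).fst)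
      rw [h, h1]
    exact fun w => congrArg Multiplicative.toAdd (DFunLike.congr_fun hpq w)
  -- `D` measures how far `ν` is from acting as `g` on second coordinates. The cocycle `½ a ∧ b` is
  -- `g`-equivariant, so `D` is a homomorphism to an abelian group and cannot distinguish `φ w` from
  -- `w`.
  let D : FreeGroup ℕ →* Multiplicative (⋀[ℚ]^2 HInf) :=
    { toFun := fun w => Multiplicative.ofAdd
        ((toNil2 (ν w)).snd - extRep stdRep 2 g (toNil2 w).snd)
      map_one' := by simp [Nil2.one_snd]
      map_mul' := fun x y => by
        rw [← ofAdd_add]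
        congr 1
        simp only [map_mul, Nil2.mul_snd, hfst, map_add, map_smul, extRep_wedge]
        abel }
  have hD : ∀ w, (toNil2 (ν ((φ : MulAut (FreeGroup ℕ)) w))).snd -
      extRep stdRep 2 g (toNil2 ((φ : MulAut (FreeGroup ℕ)) w)).snd =
      (toNil2 (ν w)).snd - extRep stdRep 2 g (toNil2 w).snd := by
    intro w
    have h2 := congrArg (Abelianization.lift D) (IAInf_le_IAut φ.2 w)
    rw [Abelianization.lift_apply_of, Abelianization.lift_apply_of] at h2
    exact congrArg Multiplicative.toAdd h2
  -- Evaluation takes place at `ν w`, where `ν φ ν⁻¹` becomes `ν (φ w)`; the words `ν w` exhaust the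
  -- free group.
  have main : ∀ w, evalHom _ (johnson (conjIA hν φ)).toAdd (toNil2 (ν w)).fst =
      evalHom _ (extDualRep 2 g (johnson φ).toAdd) (toNil2 (ν w)).fst := by
    intro w
    rw [evalHom_extDualRep, evalHom_johnson, hfst]
    have h3 : stdRep g⁻¹ (stdRep g (toNil2 w).fst) = (toNil2 w).fst := by
      rw [← Module.End.mul_apply, ← map_mul, inv_mul_cancel, map_one]
      rfl
    rw [h3, evalHom_johnson]
    change (toNil2 ((conjIA hν φ : MulAut (FreeGroup ℕ)) (ν w))).snd - (toNil2 (ν w)).snd =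
      extRep stdRep 2 g ((toNil2 ((φ : MulAut (FreeGroup ℕ)) w)).snd - (toNil2 w).snd)
    rw [conjIA_coe, MulAut.mul_apply, MulAut.mul_apply, MulAut.inv_apply_self, map_sub]
    have h4 := hD w
    rw [sub_eq_sub_iff_add_eq_add] at h4 ⊢
    rw [h4, add_comm]
  apply evalHom_injective
  refine HInf_ext fun j => ?_
  have h5 := main (ν⁻¹ (FreeGroup.of j))
  have h1 : (toNil2 (FreeGroup.of j)).fst = e j := by simp [toNil2]
  rwa [MulAut.apply_inv_self, h1] at h5

/-! ### Polynomial functions and stability under elementary matrices -/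

/-- Polynomial functions of one rational variable with values in a vector space. -/
inductive PolyFun {V : Type} [AddCommGroup V] [Module ℚ V] : (ℚ → V) → Prop
  | const (v : V) : PolyFun fun _ => v
  | add {f g : ℚ → V} : PolyFun f → PolyFun g → PolyFun fun t => f t + g t
  | smul {f : ℚ → V} : PolyFun f → PolyFun fun t => t • f t

namespace PolyFun

variable {V V' V'' : Type} [AddCommGroup V] [Module ℚ V] [AddCommGroup V'] [Module ℚ V']
  [AddCommGroup V''] [Module ℚ V'']

theorem map {f : ℚ → V} (hf : PolyFun f) (L : V →ₗ[ℚ] V') : PolyFun fun t => L (f t) := by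
  induction hf with
  | const v => exact const _
  | add _ _ h1 h2 => simpa using h1.add h2
  | smul _ h => simpa using h.smul

theorem bilin {f : ℚ → V} {g : ℚ → V'} (hf : PolyFun f) (hg : PolyFun g)
    (B : V →ₗ[ℚ] V' →ₗ[ℚ] V'') : PolyFun fun t => B (f t) (g t) := by
  induction hf with
  | const v => exact hg.map (B v)
  | add _ _ h1 h2 => simpa using h1.add h2
  | smul _ h => simpa using h.smul

theorem multilinear {n : ℕ} (F : MultilinearMap ℚ (fun _ : Fin n => V) V')
    {f : Fin n → ℚ → V} (hf : ∀ j, PolyFun (f j)) : PolyFun fun t => F fun j => f j t := by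
  induction n with
  | zero =>
    have h : ∀ t, (fun j => f j t) = Fin.elim0 := fun t => funext fun j => j.elim0
    simp only [h]
    exact const _
  | succ n ih =>
    have h : ∀ t, F (fun j => f j t) = F.curryLeft (f 0 t) (fun j => f j.succ t) := fun t => by
      rw [MultilinearMap.curryLeft_apply]
      congr 1
      ext1 j
      refine Fin.cases ?_ (fun _ => ?_) j <;> rfl
    simp only [h]
    -- The first argument is made a free polynomial function so that induction can run on its
    -- construction, with the remaining arguments handled by `ih`.
    have key : ∀ g : ℚ → V, PolyFun g →
        PolyFun fun t => F.curryLeft (g t) (fun j => f j.succ t) := by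
      intro g hg
      induction hg with
      | const v => exact ih (F.curryLeft v) fun j => hf j.succ
      | add _ _ h1 h2 => simpa using h1.add h2
      | smul _ h => simpa using h.smul
    exact key _ (hf 0)

theorem exists_polynomial {f : ℚ → ℚ} (hf : PolyFun f) :
    ∃ p : Polynomial ℚ, ∀ t, f t = p.eval t := by
  induction hf with
  | const v => exact ⟨Polynomial.C v, by simp⟩
  | add _ _ h1 h2 =>
    obtain ⟨p, hp⟩ := h1
    obtain ⟨q, hq⟩ := h2
    exact ⟨p + q, by simp [hp, hq]⟩
  | smul _ h =>
    obtain ⟨p, hp⟩ := h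
    exact ⟨Polynomial.X * p, by simp [hp]⟩

/-- A polynomial function with values in a subspace at all natural numbers takes all its values
in this subspace. -/
theorem mem_of_forall_nat {f : ℚ → V} (hf : PolyFun f) (W : Submodule ℚ V)
    (h : ∀ k : ℕ, f k ∈ W) (t : ℚ) : f t ∈ W := by
  by_contra ht
  -- A linear form that kills `W` but not `f t` turns `f` into a scalar polynomial with all natural
  -- numbers as roots.
  obtain ⟨l, hl, hW⟩ := Submodule.exists_le_ker_of_notMem ht
  obtain ⟨p, hp⟩ := (hf.map l).exists_polynomial
  have hp0 : p = 0 := by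
    refine Polynomial.eq_zero_of_infinite_isRoot p ?_
    refine (Set.infinite_range_of_injective (Nat.cast_injective (R := ℚ))).mono ?_
    rintro _ ⟨k, rfl⟩
    exact (hp k).symm.trans (hW (h k))
  exact hl (by rw [hp, hp0, Polynomial.eval_zero])

end PolyFun

/-- The elementary matrix in `GL(∞, ℚ)` with `e_a ↦ e_a + t e_b`. -/
def elem {a b : ℕ} (hab : a ≠ b) (t : ℚ) : GLInf :=
  ⟨LinearEquiv.transvection (f := Finsupp.lapply (R := ℚ) a) (v := t • e b)
      (by simp [e, hab.symm]), max a b + 1, fun j hj => by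
    have ha : j ≠ a := by omega
    have hb : j ≠ b := by omega
    refine ⟨?_, fun v => ?_⟩
    · change e j + (e j) a • t • e b = e j
      simp [e, ha]
    · change (v + v a • t • e b) j = v j
      simp [e, hb.symm]⟩

theorem stdRep_elem {a b : ℕ} (hab : a ≠ b) (t : ℚ) (v : HInf) :
    stdRep (elem hab t) v = v + (t * v a) • e b := by
  change v + v a • t • e b = _
  rw [smul_smul, mul_comm]

theorem GLInf_ext {g h : GLInf} (H : ∀ j, stdRep g (e j) = stdRep h (e j)) : g = h := by
  have h2 : stdRep g = stdRep h := HInf_ext H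
  exact Subtype.ext (LinearEquiv.toLinearMap_injective h2)

theorem elem_mul {a b : ℕ} (hab : a ≠ b) (s t : ℚ) :
    elem hab s * elem hab t = elem hab (s + t) := by
  refine GLInf_ext fun j => ?_
  rw [map_mul, Module.End.mul_apply]
  simp only [stdRep_elem, Finsupp.add_apply, Finsupp.smul_apply]
  have h : (e b) a = 0 := by simp [e, hab.symm]
  rw [h]
  module

theorem elem_zero {a b : ℕ} (hab : a ≠ b) : elem hab 0 = 1 :=
  GLInf_ext fun j => by simp [stdRep_elem]

theorem elem_inv {a b : ℕ} (hab : a ≠ b) (t : ℚ) : (elem hab t)⁻¹ = elem hab (-t) := by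
  rw [inv_eq_iff_mul_eq_one, elem_mul, add_neg_cancel, elem_zero]

theorem elem_natCast {a b : ℕ} (hab : a ≠ b) (k : ℕ) : elem hab k = elem hab 1 ^ k := by
  induction k with
  | zero => simp [elem_zero]
  | succ k ih => rw [pow_succ, ← ih, elem_mul, Nat.cast_succ]

theorem dualRep_elem {a b : ℕ} (hab : a ≠ b) (t : ℚ) (d : HDual) :
    dualRep (elem hab t) d = d - (t * (d : Module.Dual ℚ HInf) (e b)) • eDual a := by
  refine Subtype.ext (LinearMap.ext fun v => ?_)
  rw [dualRep_apply, elem_inv, stdRep_elem]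
  simp only [map_add, map_smul, smul_eq_mul, Submodule.coe_sub, Submodule.coe_smul,
    LinearMap.sub_apply, LinearMap.smul_apply, eDual_apply]
  ring

theorem polyFun_stdRep_elem {a b : ℕ} (hab : a ≠ b) (v : HInf) :
    PolyFun fun t => stdRep (elem hab t) v := by
  simp only [stdRep_elem, mul_smul]
  exact (PolyFun.const v).add (PolyFun.const _).smul

theorem polyFun_dualRep_elem {a b : ℕ} (hab : a ≠ b) (d : HDual) :
    PolyFun fun t => dualRep (elem hab t) d := by
  have h : ∀ t, dualRep (elem hab t) d =
      d + t • (-(d : Module.Dual ℚ HInf) (e b)) • eDual a := fun t => by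
    rw [dualRep_elem]
    module
  simp only [h]
  exact (PolyFun.const d).add (PolyFun.const _).smul

theorem polyFun_extRep {V : Type} [AddCommGroup V] [Module ℚ V] (ρ : Representation ℚ GLInf V)
    (g : ℚ → GLInf) (h : ∀ v, PolyFun fun t => ρ (g t) v) (i : ℕ) (x : ⋀[ℚ]^i V) :
    PolyFun fun t => extRep ρ i (g t) x := by
  have hx : x ∈ Submodule.span ℚ (Set.range (exteriorPower.ιMulti ℚ i (M := V))) := by
    rw [exteriorPower.ιMulti_span]
    trivial
  induction hx using Submodule.span_induction with
  | mem x hx =>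
    obtain ⟨u, rfl⟩ := hx
    simp only [extRep_ιMulti]
    exact PolyFun.multilinear (exteriorPower.ιMulti ℚ i (M := V)).toMultilinearMap fun j => h (u j)
  | zero => simpa using PolyFun.const 0
  | add x y _ _ hx hy => simpa using hx.add hy
  | smul c x _ hx =>
    simp only [map_smul]
    exact hx.map (LinearMap.lsmul ℚ _ c)

theorem polyFun_extDualRep_elem (k : ℕ) {a b : ℕ} (hab : a ≠ b)
    (u : (⋀[ℚ]^k HInf) ⊗[ℚ] HDual) : PolyFun fun t => extDualRep k (elem hab t) u := by
  induction u using TensorProduct.induction_on with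
  | zero => simpa using PolyFun.const 0
  | tmul w d =>
    simp only [extDualRep_tmul]
    exact PolyFun.bilin (V'' := (⋀[ℚ]^k HInf) ⊗[ℚ] HDual)
      (polyFun_extRep stdRep _ (polyFun_stdRep_elem hab) k w)
      (polyFun_dualRep_elem hab d) (TensorProduct.mk ℚ (⋀[ℚ]^k HInf) HDual)
  | add x y hx hy => simpa using hx.add hy

/-- The Nielsen automorphism `x_a ↦ x_a x_b`. -/
def nielsen {a b : ℕ} (hab : a ≠ b) : MulAut (FreeGroup ℕ) :=
  MonoidHom.toMulEquiv
    (FreeGroup.lift fun j => if j = a then FreeGroup.of a * FreeGroup.of b else FreeGroup.of j)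
    (FreeGroup.lift fun j => if j = a then FreeGroup.of a * (FreeGroup.of b)⁻¹ else FreeGroup.of j)
    (FreeGroup.ext_hom _ _ fun j => by by_cases h : j = a <;> simp [h, hab.symm])
    (FreeGroup.ext_hom _ _ fun j => by by_cases h : j = a <;> simp [h, hab.symm])

theorem nielsen_of {a b : ℕ} (hab : a ≠ b) (j : ℕ) : nielsen hab (FreeGroup.of j) =
    if j = a then FreeGroup.of a * FreeGroup.of b else FreeGroup.of j :=
  FreeGroup.lift_apply_of

theorem nielsen_inv_of {a b : ℕ} (hab : a ≠ b) (j : ℕ) : (nielsen hab)⁻¹ (FreeGroup.of j) =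
    if j = a then FreeGroup.of a * (FreeGroup.of b)⁻¹ else FreeGroup.of j :=
  FreeGroup.lift_apply_of

theorem nielsen_mem_finAut {a b : ℕ} (hab : a ≠ b) :
    nielsen hab ∈ finAut (max a b + 1) := by
  have ha := of_mem_range_map_val (n := max a b + 1) (j := a) (by omega)
  have hb := of_mem_range_map_val (n := max a b + 1) (j := b) (by omega)
  refine mem_finAut_of_forall (fun j hj => ?_) (fun j hj => ?_) (fun j hj => ?_)
  · rw [nielsen_of, if_neg (by omega)]
  · rw [nielsen_of]
    split_ifs
    · exact mul_mem ha hb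
    · exact of_mem_range_map_val hj
  · rw [nielsen_inv_of]
    split_ifs
    · exact mul_mem ha (inv_mem hb)
    · exact of_mem_range_map_val hj

/-- Supplies the hypothesis of `johnson_conjIA`: integral elementary matrices are realized by
automorphisms of the free group, which is not so for general `t`. -/
theorem toNil2_nielsen_fst {a b : ℕ} (hab : a ≠ b) (j : ℕ) :
    (toNil2 (nielsen hab (FreeGroup.of j))).fst = stdRep (elem hab 1) (e j) := by
  rw [nielsen_of, stdRep_elem]
  split_ifs with h
  · subst h
    simp [toNil2, Nil2.mul_fst, e]
  · simp [toNil2, e, h]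

/-- The endomorphism `e_k ↦ c e_k` of `H`, fixing the other basis vectors. -/
def scaleAt (k : ℕ) (c : ℚ) : HInf →ₗ[ℚ] HInf :=
  LinearMap.id + (Finsupp.lapply (R := ℚ) k).smulRight ((c - 1) • e k)

theorem scaleAt_apply (k : ℕ) (c : ℚ) (v : HInf) :
    scaleAt k c v = v + v k • (c - 1) • e k := rfl

theorem scaleAt_comp (k : ℕ) {s t : ℚ} (h : s * t = 1) :
    scaleAt k s ∘ₗ scaleAt k t = LinearMap.id := by
  refine LinearMap.ext fun v => ?_
  have hk : (e k) k = 1 := by simp [e]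
  simp only [LinearMap.comp_apply, scaleAt_apply, Finsupp.add_apply, Finsupp.smul_apply, hk,
    LinearMap.id_apply, smul_eq_mul]
  match_scalars
  · ring
  · linear_combination v k * h

/-- The diagonal matrix `e_k ↦ t e_k` in `GL(∞, ℚ)`. -/
def dil (k : ℕ) (t : ℚˣ) : GLInf :=
  ⟨LinearEquiv.ofLinearMap (scaleAt k t) (scaleAt k (↑t⁻¹ : ℚ))
      (scaleAt_comp k (by simp)) (scaleAt_comp k (by simp)), k + 1, fun j hj => by
    have hk : j ≠ k := by omega
    refine ⟨?_, fun v => ?_⟩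
    · change e j + (e j) k • ((t : ℚ) - 1) • e k = e j
      simp [e, hk]
    · change (v + v k • ((t : ℚ) - 1) • e k) j = v j
      simp [e, hk.symm]⟩

theorem stdRep_dil (k : ℕ) (t : ℚˣ) (v : HInf) :
    stdRep (dil k t) v = v + (v k * ((t : ℚ) - 1)) • e k := by
  rw [mul_smul]
  rfl

theorem stdRep_dil_e (k : ℕ) (t : ℚˣ) (j : ℕ) :
    stdRep (dil k t) (e j) = (if j = k then (t : ℚ) else 1) • e j := by
  rw [stdRep_dil]
  split_ifs with h
  · subst h
    simp only [e, Finsupp.single_eq_same]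
    module
  · simp [e, h]

theorem stdRep_elem_e {a b : ℕ} (hab : a ≠ b) (t : ℚ) (j : ℕ) :
    stdRep (elem hab t) (e j) = e j + (if j = a then t else 0) • e b := by
  rw [stdRep_elem]
  split_ifs with h
  · simp [e, h]
  · simp [e, h]

theorem dil_inv (k : ℕ) (t : ℚˣ) : (dil k t)⁻¹ = dil k t⁻¹ := by
  rw [inv_eq_iff_mul_eq_one]
  refine GLInf_ext fun j => ?_
  rw [map_mul, Module.End.mul_apply, stdRep_dil_e, map_smul, stdRep_dil_e, map_one]
  split_ifs <;> simp [smul_smul]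

/-- Whitehead's lemma for a pair of diagonal entries. -/
theorem dil_mul_dil_inv {a b : ℕ} (hab : a ≠ b) (t : ℚˣ) :
    dil a t * dil b t⁻¹ = elem hab (-(↑t⁻¹ : ℚ)) * elem hab.symm (t : ℚ) *
      elem hab (-(↑t⁻¹ : ℚ)) * (elem hab 1 * elem hab.symm (-1) * elem hab 1) := by
  -- With `E`, `E'` the two elementary families, `E(s) E'(-1/s) E(s)` is monomial: `e_a ↦ s e_b` and
  -- `e_b ↦ -s⁻¹ e_a`. The right side is the product of these for `s = -t⁻¹` and `s = 1`.
  refine GLInf_ext fun j => ?_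
  simp only [map_mul, Module.End.mul_apply, stdRep_dil_e, stdRep_elem_e, map_add, map_smul]
  by_cases h : j = a
  · subst h
    simp only [if_true, if_neg hab, if_neg hab.symm]
    simp only [Units.val_inv_eq_inv_val]
    match_scalars <;> field_simp <;> ring
  · by_cases h2 : j = b
    · subst h2
      simp only [if_true, if_neg hab, if_neg hab.symm]
      simp only [Units.val_inv_eq_inv_val]
      match_scalars <;> field_simp <;> ring
    · simp [h, h2]

/-- The endomorphism of `H` with matrix `A ⊕ 1`. -/
def blockEnd (n : ℕ) (A : Matrix (Fin n) (Fin n) ℚ) : HInf →ₗ[ℚ] HInf :=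
  Finsupp.linearCombination ℚ fun j =>
    if h : j < n then ∑ i : Fin n, A i ⟨j, h⟩ • e i else e j

theorem blockEnd_e_lt {n : ℕ} (A : Matrix (Fin n) (Fin n) ℚ) (j : Fin n) :
    blockEnd n A (e j) = ∑ i : Fin n, A i j • e i := by
  simp [blockEnd, e]

theorem blockEnd_e_ge {n : ℕ} (A : Matrix (Fin n) (Fin n) ℚ) {j : ℕ} (hj : n ≤ j) :
    blockEnd n A (e j) = e j := by
  simp [blockEnd, e, hj.not_gt]

theorem blockEnd_ext {n : ℕ} {A : Matrix (Fin n) (Fin n) ℚ} {L : HInf →ₗ[ℚ] HInf}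
    (h1 : ∀ j : Fin n, L (e j) = ∑ i : Fin n, A i j • e i) (h2 : ∀ j, n ≤ j → L (e j) = e j) :
    L = blockEnd n A := by
  refine HInf_ext fun j => ?_
  by_cases hj : j < n
  · exact (h1 ⟨j, hj⟩).trans (blockEnd_e_lt A ⟨j, hj⟩).symm
  · rw [h2 j (not_lt.mp hj), blockEnd_e_ge A (not_lt.mp hj)]

theorem blockEnd_mul {n : ℕ} (A B : Matrix (Fin n) (Fin n) ℚ) :
    blockEnd n A * blockEnd n B = blockEnd n (A * B) := by
  refine blockEnd_ext (fun j => ?_) (fun j hj => ?_)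
  · simp only [Module.End.mul_apply, blockEnd_e_lt, map_sum, map_smul, Matrix.mul_apply,
      Finset.smul_sum, Finset.sum_smul, smul_smul]
    rw [Finset.sum_comm]
    simp only [mul_comm]
  · rw [Module.End.mul_apply, blockEnd_e_ge B hj, blockEnd_e_ge A hj]

theorem blockEnd_one (n : ℕ) : blockEnd n 1 = 1 := by
  refine (blockEnd_ext (fun j => ?_) (fun j _ => rfl)).symm
  simp [Matrix.one_apply]

theorem blockEnd_injective (n : ℕ) : Function.Injective (blockEnd n) := by
  intro A B h
  ext i j
  have h1 := LinearMap.congr_fun h (e j)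
  rw [blockEnd_e_lt, blockEnd_e_lt] at h1
  have h2 := DFunLike.congr_fun h1 (i : ℕ)
  simpa [Finsupp.finsetSum_apply, e, Finsupp.single_apply, Fin.val_inj] using h2

theorem exists_eq_blockEnd (g : GLInf) {n : ℕ}
    (hn : ∀ j, n ≤ j → (g : HInf ≃ₗ[ℚ] HInf) (e j) = e j ∧
      ∀ v, (g : HInf ≃ₗ[ℚ] HInf) v j = v j) : ∃ A, stdRep g = blockEnd n A := by
  refine ⟨fun i j => stdRep g (e j) i, blockEnd_ext (fun j => ?_) fun j hj => (hn j hj).1⟩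
  ext k
  simp only [Finsupp.finsetSum_apply, Finsupp.smul_apply, e, Finsupp.single_apply, smul_eq_mul,
    mul_ite, mul_one, mul_zero]
  by_cases hk : k < n
  · rw [Finset.sum_eq_single ⟨k, hk⟩]
    · simp
    · intro i _ hi
      rw [if_neg fun h => hi (Fin.ext h)]
    · simp
  · rw [Finset.sum_eq_zero]
    -- Here the row condition in `GLInf` enters: it excludes components outside the block, which the
    -- column condition alone would allow.
    · have := (hn k (not_lt.mp hk)).2 (Finsupp.single (j : ℕ) 1)
      refine this.trans ?_
      rw [Finsupp.single_apply, if_neg (by omega)]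
    · intro i _
      rw [if_neg (by omega)]

/-- `GL(∞, ℚ)` is generated by elementary and diagonal matrices. -/
theorem GLInf_mem_of_elem_of_dil (S : Submonoid GLInf)
    (h1 : ∀ (a b : ℕ) (hab : a ≠ b) (t : ℚ), elem hab t ∈ S) (h2 : ∀ k t, dil k t ∈ S)
    (g : GLInf) : g ∈ S := by
  obtain ⟨n, hn⟩ := g.2
  obtain ⟨m, hm⟩ := (g⁻¹).2
  set N := max m n
  obtain ⟨A, hA⟩ := exists_eq_blockEnd g (n := N) fun j hj => hn j (by omega)
  obtain ⟨B, hB⟩ := exists_eq_blockEnd g⁻¹ (n := N) fun j hj => hm j (by omega)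
  -- `g` and `g⁻¹` are blocks of one common size, so the block of `g` is an invertible matrix and
  -- Gaussian elimination applies.
  have hAB : A * B = 1 := by
    apply blockEnd_injective
    rw [← blockEnd_mul, ← hA, ← hB, ← map_mul, mul_inv_cancel, map_one, blockEnd_one]
  have hdet : A.det ≠ 0 := fun h0 => by
    have := congrArg Matrix.det hAB
    rw [Matrix.det_mul, h0, zero_mul, Matrix.det_one] at this
    exact zero_ne_one this
  obtain ⟨g', hg', hS⟩ : ∃ g', stdRep g' = blockEnd N A ∧ g' ∈ S := by
    refine Matrix.diagonal_transvection_induction_of_det_ne_zero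
      (fun A => ∃ g', stdRep g' = blockEnd N A ∧ g' ∈ S) A hdet ?_ ?_ ?_
    · intro D hD
      have hD0 : ∀ i, D i ≠ 0 := fun i => by
        rw [Matrix.det_diagonal, Finset.prod_ne_zero_iff] at hD
        exact hD i (Finset.mem_univ i)
      have key : ∀ s : Finset (Fin N), ∃ g', stdRep g' =
          blockEnd N (Matrix.diagonal fun i => if i ∈ s then D i else 1) ∧ g' ∈ S := by
        intro s
        induction s using Finset.induction_on with
        | empty => exact ⟨1, by simp [blockEnd_one], one_mem S⟩
        | insert k s hk ih =>
          obtain ⟨g', hg', hS⟩ := ih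
          refine ⟨dil k (Units.mk0 (D k) (hD0 k)) * g', ?_, mul_mem (h2 _ _) hS⟩
          have h3 : stdRep (dil k (Units.mk0 (D k) (hD0 k))) =
              blockEnd N (Matrix.diagonal fun i => if i = k then D k else 1) := by
            refine blockEnd_ext (fun j => ?_) (fun j hj => ?_)
            · rw [stdRep_dil_e]
              simp [Matrix.diagonal_apply, Fin.val_inj]
            · rw [stdRep_dil_e, if_neg (by omega), one_smul]
          rw [map_mul, h3, hg', blockEnd_mul, Matrix.diagonal_mul_diagonal]
          congr 2
          ext i
          by_cases hi : i = k
          · subst hi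
            simp [hk]
          · simp [hi]
      simpa using key Finset.univ
    · rintro ⟨i, j, hij, c⟩
      -- The indices are exchanged: the transvection with entry `c` in row `i`, column `j` sends
      -- `e_j` to `e_j + c e_i`.
      have hne : (j : ℕ) ≠ i := fun h => hij (Fin.ext h.symm)
      refine ⟨elem hne c, blockEnd_ext (fun k => ?_) (fun k hk => ?_), h1 _ _ _ _⟩
      · rw [stdRep_elem_e]
        simp only [Matrix.TransvectionStruct.toMatrix, Matrix.transvection, Matrix.add_apply,
          add_smul, Finset.sum_add_distrib, Matrix.one_apply, Matrix.single_apply]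
        simp only [ite_smul, one_smul, zero_smul, Finset.mem_univ, if_true,
          ite_and, Finset.sum_ite_eq, Fin.val_inj, eq_comm]
      · rw [stdRep_elem_e, if_neg (by omega), zero_smul, add_zero]
    · rintro A B - - ⟨g₁, hg₁, hS₁⟩ ⟨g₂, hg₂, hS₂⟩
      exact ⟨g₁ * g₂, by rw [map_mul, hg₁, hg₂, blockEnd_mul], mul_mem hS₁ hS₂⟩
  have : g = g' := GLInf_ext fun j => by rw [hA, hg']
  rwa [this]

/-- Every vector is fixed by almost all diagonal matrices `dil N t`. -/
def EventuallyFixed {V : Type} [AddCommGroup V] [Module ℚ V] (ρ : Representation ℚ GLInf V) :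
    Prop :=
  ∀ v, ∃ n, ∀ N ≥ n, ∀ t, ρ (dil N t) v = v

theorem eventuallyFixed_stdRep : EventuallyFixed stdRep := by
  intro v
  refine ⟨v.support.sup id + 1, fun N hN t => ?_⟩
  have h : v N = 0 := by
    by_contra h
    have := Finset.le_sup (f := id) (Finsupp.mem_support_iff.mpr h)
    simp only [id] at this
    omega
  rw [stdRep_dil, h]
  simp

theorem eventuallyFixed_dualRep : EventuallyFixed dualRep := by
  intro d
  obtain ⟨n, hn⟩ := d.2
  refine ⟨n, fun N hN t => Subtype.ext (LinearMap.ext fun v => ?_)⟩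
  rw [dualRep_apply, dil_inv, stdRep_dil, map_add, map_smul, hn N hN, smul_zero, add_zero]

theorem EventuallyFixed.extRep {V : Type} [AddCommGroup V] [Module ℚ V]
    {ρ : Representation ℚ GLInf V} (h : EventuallyFixed ρ) (i : ℕ) :
    EventuallyFixed (extRep ρ i) := by
  intro x
  have hx : x ∈ Submodule.span ℚ (Set.range (exteriorPower.ιMulti ℚ i (M := V))) := by
    rw [exteriorPower.ιMulti_span]
    trivial
  induction hx using Submodule.span_induction with
  | mem x hx =>
    obtain ⟨u, rfl⟩ := hx
    choose n hn using fun j => h (u j)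
    refine ⟨Finset.univ.sup n, fun N hN t => ?_⟩
    rw [extRep_ιMulti]
    congr 1
    exact funext fun j => hn j N ((Finset.le_sup (Finset.mem_univ j)).trans hN) t
  | zero => exact ⟨0, fun _ _ _ => map_zero _⟩
  | add x y _ _ hx hy =>
    obtain ⟨m, hm⟩ := hx
    obtain ⟨n, hn⟩ := hy
    refine ⟨max m n, fun N hN t => ?_⟩
    rw [map_add, hm N (by omega), hn N (by omega)]
  | smul c x _ hx =>
    obtain ⟨m, hm⟩ := hx
    exact ⟨m, fun N hN t => by rw [map_smul, hm N hN]⟩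

theorem eventuallyFixed_extDualRep (k : ℕ) :
    EventuallyFixed (V := (⋀[ℚ]^k HInf) ⊗[ℚ] HDual) (extDualRep k) := by
  intro u
  induction u using TensorProduct.induction_on with
  | zero => exact ⟨0, fun _ _ _ => map_zero _⟩
  | tmul w d =>
    obtain ⟨m, hm⟩ := eventuallyFixed_stdRep.extRep k w
    obtain ⟨n, hn⟩ := eventuallyFixed_dualRep d
    refine ⟨max m n, fun N hN t => ?_⟩
    rw [extDualRep_tmul, hm N (by omega), hn N (by omega)]
  | add x y hx hy =>
    obtain ⟨m, hm⟩ := hx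
    obtain ⟨n, hn⟩ := hy
    refine ⟨max m n, fun N hN t => ?_⟩
    rw [map_add, hm N (by omega), hn N (by omega)]

/-- A subspace of a locally polynomial representation of `GL(∞, ℚ)` that is stable under the
integral elementary matrices is a subrepresentation. -/
theorem stable_of_elem_one {V : Type} [AddCommGroup V] [Module ℚ V]
    (ρ : Representation ℚ GLInf V) (hfix : EventuallyFixed ρ)
    (hpoly : ∀ (a b : ℕ) (hab : a ≠ b) (v : V), PolyFun fun t => ρ (elem hab t) v)
    (W : Submodule ℚ V)
    (hW : ∀ (a b : ℕ) (hab : a ≠ b), ∀ x ∈ W, ρ (elem hab 1) x ∈ W) (g : GLInf) :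
    ∀ x ∈ W, ρ g x ∈ W := by
  -- Only a submonoid is evident: mapping `W` into itself is not visibly inherited by inverses.
  let S : Submonoid GLInf :=
    { carrier := {g | ∀ x ∈ W, ρ g x ∈ W}
      one_mem' := fun x hx => by rwa [map_one]
      mul_mem' := fun {g h} hg hh x hx => by
        rw [map_mul]
        exact hg _ (hh x hx) }
  have hS : ∀ (a b : ℕ) (hab : a ≠ b) (t : ℚ), elem hab t ∈ S := by
    intro a b hab t x hx
    -- At a natural number `k` the elementary matrix is the `k`-th power of the integral one, so
    -- stability there is an iteration of `hW`.
    refine (hpoly a b hab x).mem_of_forall_nat W (fun k => ?_) t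
    rw [elem_natCast]
    induction k with
    | zero => simpa using hx
    | succ k ih =>
      rw [pow_succ', map_mul]
      exact hW a b hab _ ih
  refine GLInf_mem_of_elem_of_dil S hS (fun k t x hx => ?_) g
  obtain ⟨n, hn⟩ := hfix x
  -- A diagonal matrix of determinant `t ≠ 1` is no product of elementary ones. Inserting `t⁻¹` at
  -- an index beyond `n` does not change the effect on `x`, and makes Whitehead's lemma applicable.
  have hN : k ≠ max n (k + 1) := by omega
  have h : ρ (dil k t) x = ρ (dil k t * dil (max n (k + 1)) t⁻¹) x := by
    rw [map_mul, Module.End.mul_apply, hn _ (le_max_left _ _)]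
  rw [h, dil_mul_dil_inv hN]
  have hmem : elem hN (-(↑t⁻¹ : ℚ)) * elem hN.symm (t : ℚ) * elem hN (-(↑t⁻¹ : ℚ)) *
      (elem hN 1 * elem hN.symm (-1) * elem hN 1) ∈ S :=
    mul_mem (mul_mem (mul_mem (hS _ _ _ _) (hS _ _ _ _)) (hS _ _ _ _))
      (mul_mem (mul_mem (hS _ _ _ _) (hS _ _ _ _)) (hS _ _ _ _))
  exact hmem x hx

/-! ### Lifting a group action along a linear map -/

/-- If the range of a linear map `J : A → V` is stable under a representation on `V`, then the
action on the range lifts to an action on `A`. -/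
theorem exists_representation_of_stable_range {G A V : Type} [Group G] [AddCommGroup A]
    [Module ℚ A] [AddCommGroup V] [Module ℚ V] (J : A →ₗ[ℚ] V) (ρ : Representation ℚ G V)
    (h : ∀ g, ∀ x ∈ LinearMap.range J, ρ g x ∈ LinearMap.range J) :
    ∃ ρ' : Representation ℚ G A, ∀ g x, J (ρ' g x) = ρ g (J x) := by
  obtain ⟨s, hs⟩ := LinearMap.exists_rightInverse_of_surjective J.rangeRestrict
    (LinearMap.range_rangeRestrict J)
  have hs' : ∀ y, J (s y) = y := fun y => congrArg Subtype.val (LinearMap.congr_fun hs y)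
  have hs2 : ∀ x, ∀ y : LinearMap.range J, J x = y → J.rangeRestrict x = y := fun x y hxy =>
    Subtype.ext hxy
  -- `A` splits as the kernel of `J` plus the image of the section `s`; the group acts through `ρ`
  -- on the second summand and trivially on the kernel.
  let T : G → A →ₗ[ℚ] A := fun g =>
    s ∘ₗ (ρ g).restrict (h g) ∘ₗ J.rangeRestrict + (LinearMap.id - s ∘ₗ J.rangeRestrict)
  have hT : ∀ g x, T g x = s ((ρ g).restrict (h g) (J.rangeRestrict x)) +
      (x - s (J.rangeRestrict x)) := fun _ _ => rfl
  have hJs : ∀ y, J.rangeRestrict (s y) = y := fun y => hs2 _ _ (hs' y)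
  have hJT : ∀ g x, J.rangeRestrict (T g x) = (ρ g).restrict (h g) (J.rangeRestrict x) := by
    intro g x
    rw [hT, map_add, map_sub, hJs, hJs, sub_self, add_zero]
  refine ⟨{ toFun := T, map_one' := ?_, map_mul' := ?_ }, fun g x => ?_⟩
  · refine LinearMap.ext fun x => ?_
    have h1 : (ρ 1).restrict (h 1) (J.rangeRestrict x) = J.rangeRestrict x :=
      Subtype.ext (by rw [LinearMap.coe_restrict_apply, map_one]; rfl)
    rw [hT, h1, add_sub_cancel]
    rfl
  · intro g₁ g₂
    refine LinearMap.ext fun x => ?_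
    rw [Module.End.mul_apply, hT g₁, hJT, hT g₂ x, hT (g₁ * g₂)]
    have h2 : (ρ (g₁ * g₂)).restrict (h (g₁ * g₂)) (J.rangeRestrict x) =
        (ρ g₁).restrict (h g₁) ((ρ g₂).restrict (h g₂) (J.rangeRestrict x)) :=
      Subtype.ext (by
        rw [LinearMap.coe_restrict_apply, map_mul]
        rfl)
    rw [h2]
    abel
  · exact congrArg Subtype.val (hJT g x)

/-- If the elementary matrices `e_a ↦ e_a + e_b` are induced by endomorphisms of `G`, then the
action of `GL(∞, ℚ)` on `⋀ⁱ V` lifts to the Albanese homology of `G`. -/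
theorem exists_representation_albaneseHomology {G V : Type} [Group G] [AddCommGroup V]
    [Module ℚ V] (f : G →* Multiplicative V) (ρ : Representation ℚ GLInf V)
    (hfix : EventuallyFixed ρ)
    (hpoly : ∀ (a b : ℕ) (hab : a ≠ b) (v : V), PolyFun fun t => ρ (elem hab t) v)
    (haut : ∀ (a b : ℕ) (hab : a ≠ b), ∃ c : G →* G,
      ∀ x, (f (c x)).toAdd = ρ (elem hab 1) (f x).toAdd) (i : ℕ) :
    ∃ ρ' : Representation ℚ GLInf (AlbaneseHomology G i), ∀ g x,
      (abToExterior f i ∘ₗ (AlbaneseHomology G i).subtype) (ρ' g x) =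
        extRep ρ i g ((abToExterior f i ∘ₗ (AlbaneseHomology G i).subtype) x) := by
  refine exists_representation_of_stable_range _ _ fun g => ?_
  rw [range_abToExterior]
  refine stable_of_elem_one (extRep ρ i) (hfix.extRep i)
    (fun a b hab x => polyFun_extRep ρ _ (hpoly a b hab) i x) _ (fun a b hab x hx => ?_) g
  obtain ⟨c, hc⟩ := haut a b hab
  exact map_mem_range_homToExterior f c (ρ (elem hab 1)) hc i hx

theorem johnson_conjIA_nielsen {a b : ℕ} (hab : a ≠ b) (φ : IAInf) :
    (johnson (conjIA (nielsen_mem_finAut hab) φ)).toAdd =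
      extDualRep 2 (elem hab 1) (johnson φ).toAdd :=
  johnson_conjIA (nielsen_mem_finAut hab) _ (toNil2_nielsen_fst hab) φ

theorem exists_representation_johnsonAlbanese (i : ℕ) :
    ∃ ρ : Representation ℚ GLInf (AlbaneseHomology IAInf i),
      ∀ g x, johnsonAlbanese i (ρ g x) = extURep i g (johnsonAlbanese i x) := by
  have h := exists_representation_albaneseHomology (G := IAInf) (V := UInf) johnson (extDualRep 2)
    (eventuallyFixed_extDualRep 2)
  have h2 := h fun _ _ hab v => polyFun_extDualRep_elem 2 hab v
  obtain ⟨ρ, hρ⟩ := h2 (fun a b hab => ⟨conjIA (nielsen_mem_finAut hab),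
      fun φ => johnson_conjIA_nielsen hab φ⟩) i
  refine ⟨ρ, fun g x => ?_⟩
  have := hρ g x
  exact this

/-! ### Equivariance of the contraction -/

/-- The action of `GL(∞, ℚ)` on `H^{⊗2} ⊗ H*`. -/
def tensorAct (g : GLInf) : TInf →ₗ[ℚ] TInf :=
  TensorProduct.map (TensorProduct.map (stdRep g) (stdRep g)) (dualRep g)

theorem phi_extDualRep (g : GLInf) (u : UInf) :
    phi (extDualRep 2 g u) = tensorAct g (phi u) := by
  induction u using TensorProduct.induction_on with
  | zero => simp
  | tmul w d =>
    have hw : w ∈ Submodule.span ℚ (Set.range (exteriorPower.ιMulti ℚ 2 (M := HInf))) := by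
      rw [exteriorPower.ιMulti_span]
      trivial
    induction hw using Submodule.span_induction with
    | mem w hw =>
      obtain ⟨v, rfl⟩ := hw
      have hv : exteriorPower.ιMulti ℚ 2 v = wedge (v 0) (v 1) := by
        rw [wedge]
        congr 1
        ext1 j
        fin_cases j <;> rfl
      rw [hv, extDualRep_tmul, extRep_wedge, phi_wedge, phi_wedge]
      simp [tensorAct, TensorProduct.sub_tmul]
    | zero => simp
    | add x y _ _ hx hy => simp only [TensorProduct.add_tmul, map_add, hx, hy]
    | smul c x _ hx => simp only [← TensorProduct.smul_tmul', map_smul, hx]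
  | add x y hx hy => simp only [map_add, hx, hy]

theorem wedgeLeft_extRep (k : ℕ) (g : GLInf) (a : HInf) (w : ⋀[ℚ]^k HInf) :
    wedgeLeft k (stdRep g a) (extRep stdRep k g w) =
      extRep stdRep (k + 1) g (wedgeLeft k a w) := by
  have hw : w ∈ Submodule.span ℚ (Set.range (exteriorPower.ιMulti ℚ k (M := HInf))) := by
    rw [exteriorPower.ιMulti_span]
    trivial
  induction hw using Submodule.span_induction with
  | mem w hw =>
    obtain ⟨v, rfl⟩ := hw
    rw [extRep_ιMulti, wedgeLeft_ιMulti, wedgeLeft_ιMulti, extRep_ιMulti]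
    congr 1
    ext1 j
    refine Fin.cases ?_ (fun _ => ?_) j <;> rfl
  | zero => simp
  | add x y _ _ hx hy => simp only [map_add, hx, hy]
  | smul c x _ hx => simp only [map_smul, hx]

theorem dualRep_stdRep (g : GLInf) (d : HDual) (v : HInf) :
    (dualRep g d : Module.Dual ℚ HInf) (stdRep g v) = (d : Module.Dual ℚ HInf) v := by
  rw [dualRep_apply, ← Module.End.mul_apply, ← map_mul, inv_mul_cancel, map_one]
  rfl

/-- The scalar `d'(b)` is invariant because `H*` carries the contragredient action; the other
factors are simply transported. -/
theorem contractStep_equivariant (k : ℕ) (g : GLInf) (t : TInf)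
    (y : (⋀[ℚ]^k HInf) ⊗[ℚ] HDual) :
    contractStep k (tensorAct g t) (extDualRep k g y) =
      extDualRep (k + 1) g (contractStep k t y) := by
  induction t using TensorProduct.induction_on with
  | zero => simp
  | add t t' ht ht' => simp only [map_add, LinearMap.add_apply, ht, ht']
  | tmul ab d =>
    induction ab using TensorProduct.induction_on with
    | zero => simp
    | add t t' ht ht' => simp only [TensorProduct.add_tmul, map_add, LinearMap.add_apply, ht, ht']
    | tmul a b =>
      induction y using TensorProduct.induction_on with
      | zero => simp
      | add y y' hy hy' => simp only [map_add, hy, hy']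
      | tmul w d' =>
        have h : tensorAct g ((a ⊗ₜ[ℚ] b) ⊗ₜ[ℚ] d) =
          (stdRep g a ⊗ₜ[ℚ] stdRep g b) ⊗ₜ[ℚ] dualRep g d := rfl
        rw [h, extDualRep_tmul, contractStep_tmul, contractStep_tmul, map_smul, extDualRep_tmul, dualRep_stdRep, wedgeLeft_extRep]

theorem contractMulti_one (t : Fin 1 → TInf) : contractMulti 1 t =
    TensorProduct.map (TensorProduct.lift wedgeBilin) LinearMap.id (t 0) := rfl

theorem contractMulti_equivariant (m : ℕ) (g : GLInf) (t : Fin (m + 1) → TInf) :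
    contractMulti (m + 1) (fun j => tensorAct g (t j)) =
      extDualRep (m + 2) g (contractMulti (m + 1) t) := by
  induction m with
  | zero =>
    rw [contractMulti_one, contractMulti_one]
    generalize t 0 = x
    induction x using TensorProduct.induction_on with
    | zero => simp
    | add t t' ht ht' => simp only [map_add, ht, ht']
    | tmul ab d =>
      induction ab using TensorProduct.induction_on with
      | zero => simp
      | add t t' ht ht' => simp only [TensorProduct.add_tmul, map_add, ht, ht']
      | tmul a b =>
        change wedge (stdRep g a) (stdRep g b) ⊗ₜ[ℚ] dualRep g d =
          extRep stdRep 2 g (wedge a b) ⊗ₜ[ℚ] dualRep g d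
        rw [extRep_wedge]
  | succ m ih =>
    rw [contractMulti_succ, contractMulti_succ, ← contractStep_equivariant, ← ih]
    rfl

theorem contraction_iota_ιMulti (m : ℕ) (u : Fin (m + 1) → UInf) :
    contraction (m + 1) (iota (m + 1) (exteriorPower.ιMulti ℚ (m + 1) u)) =
      ∑ σ : Equiv.Perm (Fin (m + 1)), ((Equiv.Perm.sign σ : ℤ) : ℚ) •
        contractMulti (m + 1) (fun j => phi (u (σ j))) := by
  rw [iota, extToTPow_ιMulti, map_sum]
  refine Finset.sum_congr rfl fun σ _ => ?_
  rw [map_smul, contraction, PiTensorProduct.lift.tprod]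

theorem contraction_iota_equivariant (m : ℕ) (g : GLInf) (x : ⋀[ℚ]^(m + 1) UInf) :
    contraction (m + 1) (iota (m + 1) (extURep (m + 1) g x)) =
      extDualRep (m + 2) g (contraction (m + 1) (iota (m + 1) x)) := by
  have hx : x ∈ Submodule.span ℚ (Set.range (exteriorPower.ιMulti ℚ (m + 1) (M := UInf))) := by
    rw [exteriorPower.ιMulti_span]
    trivial
  induction hx using Submodule.span_induction with
  | mem x hx =>
    obtain ⟨u, rfl⟩ := hx
    have h : extURep (m + 1) g (exteriorPower.ιMulti ℚ (m + 1) u) =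
      exteriorPower.ιMulti ℚ (m + 1) fun j => extDualRep 2 g (u j) := extRep_ιMulti _ _ _
    rw [h, contraction_iota_ιMulti, contraction_iota_ιMulti, map_sum]
    refine Finset.sum_congr rfl fun σ _ => ?_
    rw [map_smul, ← contractMulti_equivariant]
    simp only [phi_extDualRep]
  | zero => simp
  | add x y _ _ hx hy => simp only [map_add, hx, hy]
  | smul c x _ hx => simp only [map_smul, hx]

/-! ### Partial conjugations -/

/-- The homomorphism `x_j ↦ w x_j w⁻¹` for `j ∈ B`, fixing the other generators. -/
def conjHom (B : Finset ℕ) (w : FreeGroup ℕ) : FreeGroup ℕ →* FreeGroup ℕ :=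
  FreeGroup.lift fun j => if j ∈ B then w * FreeGroup.of j * w⁻¹ else FreeGroup.of j

theorem conjHom_of (B : Finset ℕ) (w : FreeGroup ℕ) (j : ℕ) : conjHom B w (FreeGroup.of j) =
    if j ∈ B then w * FreeGroup.of j * w⁻¹ else FreeGroup.of j :=
  FreeGroup.lift_apply_of

/-- The partial conjugation `x_j ↦ x_y x_j x_y⁻¹` for `j ∈ B`, where `y ∉ B`. -/
def partialConj {B : Finset ℕ} {y : ℕ} (hy : y ∉ B) : MulAut (FreeGroup ℕ) :=
  MonoidHom.toMulEquiv (conjHom B (FreeGroup.of y)) (conjHom B (FreeGroup.of y)⁻¹)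
    (FreeGroup.ext_hom _ _ fun j => by
      by_cases h : j ∈ B <;> simp [conjHom_of, h, hy, mul_assoc])
    (FreeGroup.ext_hom _ _ fun j => by
      by_cases h : j ∈ B <;> simp [conjHom_of, h, hy, mul_assoc])

theorem partialConj_of {B : Finset ℕ} {y : ℕ} (hy : y ∉ B) (j : ℕ) :
    partialConj hy (FreeGroup.of j) =
      if j ∈ B then FreeGroup.of y * FreeGroup.of j * (FreeGroup.of y)⁻¹ else FreeGroup.of j :=
  conjHom_of _ _ _

theorem partialConj_inv_of {B : Finset ℕ} {y : ℕ} (hy : y ∉ B) (j : ℕ) :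
    (partialConj hy)⁻¹ (FreeGroup.of j) =
      if j ∈ B then (FreeGroup.of y)⁻¹ * FreeGroup.of j * FreeGroup.of y else FreeGroup.of j := by
  refine (conjHom_of _ _ _).trans ?_
  rw [inv_inv]

theorem partialConj_mem_IAInf {B : Finset ℕ} {y : ℕ} (hy : y ∉ B) :
    partialConj hy ∈ IAInf := by
  set n := max (B.sup id) y + 1 with hn
  have hB : ∀ j ∈ B, j < n := fun j hj => by
    have := Finset.le_sup (f := id) hj
    simp only [id] at this
    omega
  have hyn : FreeGroup.of y ∈ (FreeGroup.map (Fin.val (n := n))).range :=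
    of_mem_range_map_val (by omega)
  refine mem_IAInf_of_mem_finAut (n := n) (mem_finAut_of_forall (fun j hj => ?_)
    (fun j hj => ?_) (fun j hj => ?_)) ?_
  · rw [partialConj_of, if_neg fun h => (hB j h).not_ge hj]
  · rw [partialConj_of]
    split_ifs
    · exact mul_mem (mul_mem hyn (of_mem_range_map_val hj)) (inv_mem hyn)
    · exact of_mem_range_map_val hj
  · rw [partialConj_inv_of]
    split_ifs
    · exact mul_mem (mul_mem (inv_mem hyn) (of_mem_range_map_val hj)) hyn
    · exact of_mem_range_map_val hj
  · have h : (Abelianization.of).comp (partialConj hy).toMonoidHom = Abelianization.of := by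
      refine FreeGroup.ext_hom _ _ fun j => ?_
      change Abelianization.of (partialConj hy (FreeGroup.of j)) = _
      rw [partialConj_of]
      split_ifs
      · simp
      · rfl
    exact fun w => DFunLike.congr_fun h w

/-- The partial conjugation as an element of `IA_∞`. -/
def partialConjIA {B : Finset ℕ} {y : ℕ} (hy : y ∉ B) : IAInf :=
  ⟨partialConj hy, partialConj_mem_IAInf hy⟩

/-- On the subgroup generated by `x_j`, `j ∈ C`, the second map is conjugation by `x_z`. The first
map preserves that subgroup, because `B ∪ {y} ⊆ C`, and fixes `x_z`, so it commutes with this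
conjugation; generators outside `C` are fixed by both. -/
theorem partialConjIA_commute {B C : Finset ℕ} {y z : ℕ} (hy : y ∉ B) (hz : z ∉ C)
    (hBC : B ⊆ C) (hyC : y ∈ C) : Commute (partialConjIA hy) (partialConjIA hz) := by
  have hzB : z ∉ B := fun h => hz (hBC h)
  refine Subtype.ext (MulAut_ext_of fun j => ?_)
  change partialConj hy (partialConj hz (FreeGroup.of j)) =
    partialConj hz (partialConj hy (FreeGroup.of j))
  by_cases h1 : j ∈ B
  · simp [partialConj_of, h1, hBC h1, hyC, hzB, mul_assoc]
  · by_cases h2 : j ∈ C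
    · simp [partialConj_of, h1, h2, hzB]
    · simp [partialConj_of, h1, h2]

theorem johnsonCoeff_partialConjIA {B : Finset ℕ} {y : ℕ} (hy : y ∉ B) (j : ℕ) :
    johnsonCoeff (partialConjIA hy) j = if j ∈ B then wedge (e y) (e j) else 0 := by
  have h1 : ∀ j, (toNil2 (FreeGroup.of j)).fst = e j := fun j => by simp [toNil2]
  rw [johnsonCoeff]
  change (toNil2 (partialConj hy (FreeGroup.of j) * (FreeGroup.of j)⁻¹)).snd = _
  rw [partialConj_of]
  split_ifs
  · rw [toNil2_commutator, h1, h1]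
  · rw [mul_inv_cancel, map_one, Nil2.one_snd]

theorem johnson_partialConjIA {B : Finset ℕ} {y : ℕ} (hy : y ∉ B) :
    (johnson (partialConjIA hy)).toAdd = ∑ j ∈ B, wedge (e y) (e j) ⊗ₜ[ℚ] eDual j := by
  change ∑ᶠ j, johnsonCoeff (partialConjIA hy) j ⊗ₜ[ℚ] eDual j = _
  rw [finsum_eq_sum_of_support_subset _ (s := B)]
  · refine Finset.sum_congr rfl fun j hj => ?_
    rw [johnsonCoeff_partialConjIA, if_pos hj]
  · intro j hj
    by_contra h
    apply hj
    simp only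
    rw [johnsonCoeff_partialConjIA, if_neg (by simpa using h), TensorProduct.zero_tmul]

/-! ### The contraction of a torus class -/

/-- The Johnson image of the partial conjugation of `x_{k l}`, `l ≤ s`, by `x_{k (s + 1)}`. -/
def conjTensor {m : ℕ} (k : Fin (m + 1) → ℕ) (s : Fin m) : UInf :=
  ∑ l ∈ Finset.Iio s.succ, wedge (e (k s.succ)) (e (k l)) ⊗ₜ[ℚ] eDual (k l)

/-- The sets `{k 0, …, k s}` increase with `s`, and each contains the conjugating indices of all
earlier stages. The partial conjugations therefore commute pairwise and span a torus. -/
theorem exists_homToExterior_johnson_eq {m : ℕ} (k : Fin (m + 2) → ℕ)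
    (hk : Function.Injective k) :
    ∃ x, homToExterior (G := IAInf) (V := UInf) johnson (m + 1) x =
      exteriorPower.ιMulti ℚ (m + 1) (conjTensor k) := by
  have hy : ∀ s : Fin (m + 1), k s.succ ∉ (Finset.Iio s.succ).image k := fun s h => by
    obtain ⟨l, hl, hkl⟩ := Finset.mem_image.mp h
    rw [hk hkl, Finset.mem_Iio] at hl
    exact lt_irrefl _ hl
  have hlt : ∀ s t, s < t → Commute (partialConjIA (hy s)) (partialConjIA (hy t)) :=
    fun s t hst => partialConjIA_commute _ _
      (Finset.image_subset_image fun l hl => Finset.mem_Iio.mpr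
        ((Finset.mem_Iio.mp hl).trans (Fin.succ_lt_succ_iff.mpr hst)))
      (Finset.mem_image_of_mem k (Finset.mem_Iio.mpr (Fin.succ_lt_succ_iff.mpr hst)))
  have hc : ∀ s t, Commute (partialConjIA (hy s)) (partialConjIA (hy t)) := by
    intro s t
    rcases lt_trichotomy s t with h | h | h
    · exact hlt s t h
    · rw [h]
    · exact (hlt t s h).symm
  obtain ⟨x, hx⟩ := exists_homToExterior_eq_ιMulti (G := IAInf) (V := UInf) johnson
    (fun s => partialConjIA (hy s)) hc
  refine ⟨x, hx.trans ?_⟩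
  congr 1
  ext1 s
  rw [johnson_partialConjIA, conjTensor, Finset.sum_image hk.injOn]

theorem phi_conjTensor {m : ℕ} (k : Fin (m + 1) → ℕ) (s : Fin m) :
    phi (conjTensor k s) = ∑ l ∈ Finset.Iio s.succ,
      ((e (k s.succ) ⊗ₜ[ℚ] e (k l)) ⊗ₜ[ℚ] eDual (k l) -
        (e (k l) ⊗ₜ[ℚ] e (k s.succ)) ⊗ₜ[ℚ] eDual (k l)) := by
  rw [conjTensor, map_sum]
  refine Finset.sum_congr rfl fun l _ => ?_
  rw [phi_wedge, TensorProduct.sub_tmul]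

/-- Exchanging the two end vectors supplies the minus sign that cancels the one in `φ`; this is why
no cancellation occurs in `contractMulti_conjTensor`. -/
theorem ιMulti_cons_snoc_swap {p : ℕ} (a b : HInf) (v : Fin p → HInf) :
    exteriorPower.ιMulti ℚ (p + 2) (Fin.cons b (Fin.snoc v a : Fin (p + 1) → HInf)) =
      -exteriorPower.ιMulti ℚ (p + 2) (Fin.cons a (Fin.snoc v b : Fin (p + 1) → HInf)) := by
  have h0 : (0 : Fin (p + 2)) ≠ Fin.last (p + 1) := (Fin.last_pos).ne
  rw [← (exteriorPower.ιMulti ℚ (p + 2) (M := HInf)).map_swap _ h0]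
  congr 1
  ext1 j
  refine Fin.cases ?_ (fun j => ?_) j
  · rw [Function.comp_apply, Equiv.swap_apply_left, ← Fin.succ_last, Fin.cons_succ,
      Fin.snoc_last, Fin.cons_zero]
  · refine Fin.lastCases ?_ (fun j => ?_) j
    · rw [Function.comp_apply, Fin.succ_last, Equiv.swap_apply_right, Fin.cons_zero,
        ← Fin.succ_last, Fin.cons_succ, Fin.snoc_last]
    · rw [Function.comp_apply, Equiv.swap_apply_of_ne_of_ne (Fin.succ_ne_zero _)]
      · simp
      · rw [← Fin.succ_last]
        exact fun h => (Fin.castSucc_lt_last j).ne (Fin.succ_injective _ h)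

theorem contractStep_sub (k : ℕ) (t t' : TInf) (y : (⋀[ℚ]^k HInf) ⊗[ℚ] HDual) :
    contractStep k (t - t') y = contractStep k t y - contractStep k t' y := by
  rw [eq_sub_iff_add_eq, ← LinearMap.add_apply, ← map_add, sub_add_cancel]

/-- Contracting a product of elements `conjTensor k (s j)` gives a combination with nonnegative
coefficients of the tensors `e_{s 0} ∧ … ∧ e_{s p} ∧ e_l ⊗ e_l*`. -/
theorem contractMulti_conjTensor {m p : ℕ} (k : Fin (m + 1) → ℕ) (hk : Function.Injective k)
    (s : Fin (p + 1) → Fin m) :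
    ∃ n : Fin (m + 1) → ℚ, (∀ l, 0 ≤ n l) ∧ 0 < n 0 ∧
      contractMulti (p + 1) (fun j => phi (conjTensor k (s j))) =
        ∑ l, n l • exteriorPower.ιMulti ℚ (p + 2)
          (Fin.snoc (fun j => e (k (s j).succ)) (e (k l)) : Fin (p + 2) → HInf) ⊗ₜ[ℚ]
            eDual (k l) := by
  induction p with
  | zero =>
    -- The factor `2` arises because `φ` antisymmetrizes and the wedge then identifies both terms:
    -- `e_S ∧ e_l - e_l ∧ e_S = 2 e_S ∧ e_l`.
    refine ⟨fun l => if l < (s 0).succ then 2 else 0, fun l => by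
      beta_reduce
      split_ifs <;> norm_num,
      by simp, ?_⟩
    have hs : ∀ l, (Fin.snoc (fun j => e (k (s j).succ)) (e (k l)) : Fin 2 → HInf) =
        ![e (k (s 0).succ), e (k l)] := fun l => by
      ext1 j
      fin_cases j <;> rfl
    rw [contractMulti_one, phi_conjTensor, map_sum]
    simp only [hs, ite_smul, zero_smul]
    rw [← Finset.sum_filter]
    refine Finset.sum_congr (by ext; simp) fun l _ => ?_
    have h1 : TensorProduct.map (TensorProduct.lift wedgeBilin) LinearMap.id
        ((e (k (s 0).succ) ⊗ₜ[ℚ] e (k l)) ⊗ₜ[ℚ] eDual (k l)) =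
        wedge (e (k (s 0).succ)) (e (k l)) ⊗ₜ[ℚ] eDual (k l) := rfl
    have h2 : TensorProduct.map (TensorProduct.lift wedgeBilin) LinearMap.id
        ((e (k l) ⊗ₜ[ℚ] e (k (s 0).succ)) ⊗ₜ[ℚ] eDual (k l)) =
        wedge (e (k l)) (e (k (s 0).succ)) ⊗ₜ[ℚ] eDual (k l) := rfl
    rw [map_sub, h1, h2, Nil2.wedge_swap (e (k (s 0).succ)), TensorProduct.neg_tmul, wedge]
    module
  | succ p ih =>
    obtain ⟨n, hn, hn0, h⟩ := ih (Fin.tail s)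
    set S := (s 0).succ with hS
    -- The new factor has terms `e_S ⊗ e_l ⊗ e_l*` and `-e_l ⊗ e_S ⊗ e_l*` for `l < S`. The first
    -- pairs with `e_l*` and contributes `n l`. The second pairs with `e_S*` and contributes `n S`,
    -- its sign being undone by exchanging `e_l` and `e_S`. Index `0` always survives since `0 < S`.
    refine ⟨fun l => if l < S then n l + n S else 0, fun l => ?_, ?_, ?_⟩
    · beta_reduce
      split_ifs
      · exact add_nonneg (hn l) (hn S)
      · exact le_rfl
    · beta_reduce
      rw [if_pos (Fin.succ_pos _)]
      exact add_pos_of_pos_of_nonneg hn0 (hn S)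
    · rw [contractMulti_succ]
      have ht : Fin.tail (fun j => phi (conjTensor k (s j))) =
        fun j => phi (conjTensor k (Fin.tail s j)) := rfl
      rw [ht, h, phi_conjTensor]
      simp only [ite_smul, zero_smul]
      rw [← Finset.sum_filter, map_sum (contractStep (p + 2)),
        LinearMap.sum_apply]
      refine Finset.sum_congr (by ext; simp [hS]) fun l _ => ?_
      set w : Fin (m + 1) → ⋀[ℚ]^(p + 2) HInf := fun c => exteriorPower.ιMulti ℚ (p + 2)
        (Fin.snoc (fun j => e (k (Fin.tail s j).succ)) (e (k c)) : Fin (p + 2) → HInf) with hw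
      have hstep : ∀ a b : Fin (m + 1), contractStep (p + 2)
          ((e (k a) ⊗ₜ[ℚ] e (k b)) ⊗ₜ[ℚ] eDual (k l)) (∑ c, n c • w c ⊗ₜ[ℚ] eDual (k c)) =
          n b • wedgeLeft (p + 2) (e (k a)) (w b) ⊗ₜ[ℚ] eDual (k l) := by
        intro a b
        rw [map_sum, Finset.sum_eq_single b]
        · rw [map_smul, contractStep_tmul, eDual_e, if_pos rfl, one_smul]
        · intro c _ hc
          rw [map_smul, contractStep_tmul, eDual_e, if_neg fun h => hc (hk h).symm, zero_smul,
            smul_zero]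
        · exact fun h => absurd (Finset.mem_univ b) h
      have hcons : ∀ c, wedgeLeft (p + 2) (e (k S)) (w c) = exteriorPower.ιMulti ℚ (p + 3)
          (Fin.snoc (fun j => e (k (s j).succ)) (e (k c)) : Fin (p + 3) → HInf) := by
        intro c
        rw [hw, wedgeLeft_ιMulti, Fin.cons_snoc_eq_snoc_cons]
        congr 1
        ext1 j
        refine Fin.lastCases ?_ (fun j => ?_) j
        · simp
        · simp only [Fin.snoc_castSucc]
          refine Fin.cases ?_ (fun _ => ?_) j <;> rfl
      have hswap : wedgeLeft (p + 2) (e (k l)) (w S) = -wedgeLeft (p + 2) (e (k S)) (w l) := by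
        rw [hw, wedgeLeft_ιMulti, wedgeLeft_ιMulti, ιMulti_cons_snoc_swap]
      rw [contractStep_sub]
      change contractStep (p + 2) ((e (k S) ⊗ₜ[ℚ] e (k l)) ⊗ₜ[ℚ] eDual (k l))
        (∑ c, n c • w c ⊗ₜ[ℚ] eDual (k c)) -
        contractStep (p + 2) ((e (k l) ⊗ₜ[ℚ] e (k S)) ⊗ₜ[ℚ] eDual (k l))
        (∑ c, n c • w c ⊗ₜ[ℚ] eDual (k c)) = _
      rw [hstep, hstep, hswap, hcons, TensorProduct.neg_tmul]
      module

theorem ιMulti_snoc_comp_perm {n : ℕ} (v : Fin n → HInf) (z : HInf)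
    (σ : Equiv.Perm (Fin n)) :
    exteriorPower.ιMulti ℚ (n + 1) (Fin.snoc (v ∘ σ) z : Fin (n + 1) → HInf) =
      ((Equiv.Perm.sign σ : ℤ) : ℚ) •
        exteriorPower.ιMulti ℚ (n + 1) (Fin.snoc v z : Fin (n + 1) → HInf) := by
  have h : ∀ u : Fin n → HInf, ExteriorAlgebra.ιMulti ℚ (n + 1)
      (Fin.snoc u z : Fin (n + 1) → HInf) = ExteriorAlgebra.ιMulti ℚ n u * ExteriorAlgebra.ι ℚ z := by
    intro u
    rw [ExteriorAlgebra.ιMulti_apply, List.ofFn_succ', List.concat_eq_append, List.prod_append,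
      ExteriorAlgebra.ιMulti_apply]
    simp
  apply Subtype.ext
  rw [Submodule.coe_smul, exteriorPower.ιMulti_apply_coe, exteriorPower.ιMulti_apply_coe, h, h,
    (ExteriorAlgebra.ιMulti ℚ n (M := HInf)).map_perm, ← smul_mul_assoc, Int.cast_smul_eq_zsmul,
    Units.smul_def]

/-- The sum over `σ` uses each conjugating index `k 1, …, k (m+1)` exactly once in the wedge, so a
last factor `e_{k l}` with `l ≠ 0` is a repetition and vanishes. For `l = 0`, sorting the wedge
gives the sign of `σ`, which cancels the sign in `ι`; positive numbers add up. -/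
theorem contraction_iota_conjTensor {m : ℕ} (k : Fin (m + 2) → ℕ) (hk : Function.Injective k) :
    ∃ N : ℚ, 0 < N ∧ contraction (m + 1) (iota (m + 1)
      (exteriorPower.ιMulti ℚ (m + 1) (conjTensor k))) =
        N • exteriorPower.ιMulti ℚ (m + 2)
          (Fin.snoc (fun j => e (k j.succ)) (e (k 0)) : Fin (m + 2) → HInf) ⊗ₜ[ℚ]
            eDual (k 0) := by
  choose n hn hn0 h using fun σ : Equiv.Perm (Fin (m + 1)) => contractMulti_conjTensor k hk σ
  refine ⟨∑ σ, n σ 0, Finset.sum_pos (fun σ _ => hn0 σ) Finset.univ_nonempty, ?_⟩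
  rw [contraction_iota_ιMulti, Finset.sum_smul]
  refine Finset.sum_congr rfl fun σ _ => ?_
  rw [h, Finset.sum_eq_single 0]
  · have h1 := ιMulti_snoc_comp_perm (fun j : Fin (m + 1) => e (k j.succ)) (e (k 0)) σ
    have h2 : ((fun j : Fin (m + 1) => e (k j.succ)) ∘ σ) = fun j => e (k (σ j).succ) := rfl
    rw [h2] at h1
    rw [h1, ← TensorProduct.smul_tmul', smul_smul, smul_smul]
    congr 1
    have h3 : ((Equiv.Perm.sign σ : ℤ) : ℚ) * ((Equiv.Perm.sign σ : ℤ) : ℚ) = 1 := by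
      rw [← Int.cast_mul, ← Units.val_mul, Int.units_mul_self]
      simp
    linear_combination n σ 0 * h3
  · intro l _ hl
    obtain ⟨r, rfl⟩ := Fin.exists_succ_eq.mpr hl
    have h0 : exteriorPower.ιMulti ℚ (m + 2)
        (Fin.snoc (fun j => e (k (σ j).succ)) (e (k r.succ)) : Fin (m + 2) → HInf) = 0 := by
      refine (exteriorPower.ιMulti ℚ (m + 2) (M := HInf)).map_eq_zero_of_eq _
        (i := (σ.symm r).castSucc) (j := Fin.last _) ?_ (Fin.castSucc_lt_last _).ne
      rw [Fin.snoc_castSucc, Fin.snoc_last, Equiv.apply_symm_apply]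
    rw [h0, TensorProduct.zero_tmul, smul_zero]
  · exact fun h => absurd (Finset.mem_univ _) h

/-! ### Generation of `(⋀ⁿ H) ⊗ H*` and its dimension -/

theorem span_range_e : Submodule.span ℚ (Set.range e) = ⊤ := by
  have h := (Finsupp.basisSingleOne (R := ℚ) (ι := ℕ)).span_eq
  rwa [Finsupp.coe_basisSingleOne] at h

theorem eq_top_of_forall_ιMulti_e (n : ℕ) (R : Submodule ℚ ((⋀[ℚ]^n HInf) ⊗[ℚ] HDual))
    (h : ∀ (I : Fin n → ℕ) (j : ℕ), exteriorPower.ιMulti ℚ n (fun t => e (I t)) ⊗ₜ eDual j ∈ R) :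
    R = ⊤ := by
  rw [eq_top_iff, ← TensorProduct.span_tmul_eq_top, Submodule.span_le]
  rintro _ ⟨w, d, rfl⟩
  have hw : w ∈ Submodule.span ℚ (exteriorPower.ιMulti ℚ n (M := HInf) ''
      {a | Set.range a ⊆ Set.range e}) := by
    rw [exteriorPower.ιMulti_span_of_span ℚ n HInf span_range_e]
    trivial
  induction hw using Submodule.span_induction with
  | mem w hw =>
    obtain ⟨a, ha, rfl⟩ := hw
    choose I hI using fun t => ha ⟨t, rfl⟩
    obtain ⟨N, hN⟩ := HDual_eq_sum d
    rw [hN N le_rfl, TensorProduct.tmul_sum, ← show (fun t => e (I t)) = a from funext hI]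
    refine sum_mem fun j _ => ?_
    rw [TensorProduct.tmul_smul]
    exact R.smul_mem _ (h I j)
  | zero => simp
  | add x y _ _ hx hy =>
    rw [TensorProduct.add_tmul]
    exact add_mem hx hy
  | smul c x _ hx =>
    rw [← TensorProduct.smul_tmul']
    exact R.smul_mem c hx

/-- A subrepresentation of `(⋀ⁿ⁺¹ H) ⊗ H*` is everything if it contains the tensors
`e_{I 0} ∧ … ∧ e_{I n} ⊗ e_{I n}*`. -/
theorem eq_top_of_stable (n : ℕ) (R : Submodule ℚ ((⋀[ℚ]^(n + 1) HInf) ⊗[ℚ] HDual))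
    (hR : ∀ g, ∀ x ∈ R, extDualRep (n + 1) g x ∈ R)
    (h : ∀ I : Fin (n + 1) → ℕ, Function.Injective I →
      exteriorPower.ιMulti ℚ (n + 1) (fun t => e (I t)) ⊗ₜ eDual (I (Fin.last n)) ∈ R) :
    R = ⊤ := by
  refine eq_top_of_forall_ιMulti_e (n + 1) R fun I j => ?_
  by_cases hI : Function.Injective I
  swap
  · have h0 : exteriorPower.ιMulti ℚ (n + 1) (fun t => e (I t)) = 0 := by
      simp only [Function.Injective, not_forall] at hI
      obtain ⟨a, b, hab, hne⟩ := hI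
      exact (exteriorPower.ιMulti ℚ (n + 1) (M := HInf)).map_eq_zero_of_eq _
        (congrArg e hab) hne
    rw [h0, TensorProduct.zero_tmul]
    exact zero_mem R
  by_cases hj : ∃ p, I p = j
  · obtain ⟨p, rfl⟩ := hj
    -- If `j` occurs among the indices, a transposition moves it to the last place at the cost of a
    -- sign.
    have h1 := h (I ∘ Equiv.swap p (Fin.last n)) (hI.comp (Equiv.injective _))
    have h2 := (exteriorPower.ιMulti ℚ (n + 1) (M := HInf)).map_perm (fun t => e (I t))
      (Equiv.swap p (Fin.last n))
    have h3 : ((fun t => e (I t)) ∘ Equiv.swap p (Fin.last n)) =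
      fun t => e ((I ∘ Equiv.swap p (Fin.last n)) t) := rfl
    rw [h3] at h2
    rw [h2, Function.comp_apply, Equiv.swap_apply_right] at h1
    rcases Int.units_eq_one_or (Equiv.Perm.sign (Equiv.swap p (Fin.last n))) with hs | hs
    · simpa [hs] using h1
    · rw [hs] at h1
      have h4 : exteriorPower.ιMulti ℚ (n + 1) (fun t => e (I t)) ⊗ₜ[ℚ] eDual (I p) =
          (-1 : ℚ) • (((-1 : ℤˣ) • exteriorPower.ιMulti ℚ (n + 1) (fun t => e (I t))) ⊗ₜ[ℚ]
            eDual (I p)) := by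
        rw [TensorProduct.smul_tmul']
        congr 1
        simp
      rw [h4]
      exact R.smul_mem _ h1
  · have hne : ∀ p, I p ≠ j := fun p hp => hj ⟨p, hp⟩
    have h1 := h I hI
    -- The matrix `e_j ↦ e_j + e_{I n}` fixes every `e_{I t}` and sends `e_{I n}*` to `e_{I n}* -
    -- e_j*`, so a difference isolates `e_j*`.
    have h2 := hR (elem (hne (Fin.last n)).symm 1) _ h1
    have h3 : (fun t => stdRep (elem (hne (Fin.last n)).symm 1) (e (I t))) =
        fun t => e (I t) := funext fun t => by
      rw [stdRep_elem_e, if_neg (hne t), zero_smul, add_zero]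
    rw [extDualRep_tmul, extRep_ιMulti, h3, dualRep_elem, eDual_e, if_pos rfl, mul_one,
      one_smul] at h2
    have h4 : eDual j = eDual (I (Fin.last n)) +
        (-1 : ℚ) • (eDual (I (Fin.last n)) - eDual j) := by module
    rw [h4, TensorProduct.tmul_add, TensorProduct.tmul_smul]
    exact R.add_mem h1 (R.smul_mem _ h2)

/-- The determinant pairing with the dual basis is `1`. This certifies `⋀ⁿ H ≠ 0`, so that the
tensor product maps onto the infinite-dimensional space `H*`. -/
theorem exists_functional_ιMulti_e (n : ℕ) : ∃ l : Module.Dual ℚ (⋀[ℚ]^n HInf),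
    l (exteriorPower.ιMulti ℚ n fun t : Fin n => e t) = 1 := by
  refine ⟨exteriorPower.pairingDual ℚ HInf n (exteriorPower.ιMulti ℚ n
    fun t : Fin n => (eDual t : Module.Dual ℚ HInf)), ?_⟩
  have h2 : (Matrix.of fun i j : Fin n => (eDual j : Module.Dual ℚ HInf) (e i)) = 1 := by
    ext i j
    simp [eDual_e, Matrix.one_apply, Fin.val_inj]
  rw [exteriorPower.pairingDual_ιMulti_ιMulti, h2, Matrix.det_one]

theorem not_finite_HDual : ¬ Module.Finite ℚ HDual := by
  intro _
  have hinj : Function.Injective (Finsupp.linearCombination ℚ eDual) := by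
    intro c c' h
    ext j
    have key : ∀ c : ℕ →₀ ℚ, (Finsupp.linearCombination ℚ eDual c : Module.Dual ℚ HInf) (e j) =
        c j := by
      intro c
      induction c using Finsupp.induction_linear with
      | zero => simp
      | add x y hx hy => simp [hx, hy]
      | single a b =>
        rw [Finsupp.linearCombination_single, Submodule.coe_smul, LinearMap.smul_apply, eDual_e,
          Finsupp.single_apply]
        simp [eq_comm]
    rw [← key c, ← key c', h]
  have : Module.Finite ℚ (ℕ →₀ ℚ) := Module.Finite.of_injective _ hinj
  have := Module.Finite.finite_basis (Finsupp.basisSingleOne (R := ℚ) (ι := ℕ))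
  exact not_finite ℕ

theorem not_finite_exteriorPower_tensor_HDual (n : ℕ) :
    ¬ Module.Finite ℚ ((⋀[ℚ]^n HInf) ⊗[ℚ] HDual) := by
  intro _
  obtain ⟨l, hl⟩ := exists_functional_ιMulti_e n
  refine not_finite_HDual (Module.Finite.of_surjective
    ((TensorProduct.lid ℚ HDual).toLinearMap ∘ₗ TensorProduct.map l LinearMap.id) fun d =>
      ⟨(exteriorPower.ιMulti ℚ n fun t : Fin n => e t) ⊗ₜ d, ?_⟩)
  simp [hl]

/-! ### The main theorem -/

theorem ιMulti_conjTensor_mem_range {m : ℕ} (k : Fin (m + 2) → ℕ)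
    (hk : Function.Injective k) :
    ∃ x, johnsonAlbanese (m + 1) x = exteriorPower.ιMulti ℚ (m + 1) (conjTensor k) := by
  obtain ⟨x, hx⟩ := exists_homToExterior_johnson_eq k hk
  have h : exteriorPower.ιMulti ℚ (m + 1) (conjTensor k) ∈
      LinearMap.range (johnsonAlbanese (m + 1)) := by
    rw [range_johnsonAlbanese]
    exact ⟨x, hx⟩
  exact h

theorem range_cIota_eq_top {m : ℕ}
    (ρ : Representation ℚ GLInf (AlbaneseHomology IAInf (m + 1)))
    (hρ : ∀ g x, cIota (m + 1) (ρ g x) = extDualRep (m + 2) g (cIota (m + 1) x)) :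
    LinearMap.range (cIota (m + 1)) = ⊤ := by
  refine eq_top_of_stable (m + 1) _ (fun g x hx => ?_) fun I hI => ?_
  · obtain ⟨y, rfl⟩ := hx
    exact ⟨ρ g y, hρ g y⟩
  -- The torus computation singles out index `0`, the generation criterion the last one. The inverse
  -- rotation matches them and keeps the order of the other factors, so no sign appears.
  · have h0 : (finRotate (m + 2)).symm 0 = Fin.last (m + 1) := by
      rw [Equiv.symm_apply_eq, finRotate_last]
    have h1 : ∀ j : Fin (m + 1), (finRotate (m + 2)).symm j.succ = j.castSucc := fun j => by
      rw [Equiv.symm_apply_eq, finRotate_apply, Fin.coeSucc_eq_succ]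
    obtain ⟨N, hN, h⟩ := contraction_iota_conjTensor (I ∘ (finRotate (m + 2)).symm)
      (hI.comp (Equiv.injective _))
    obtain ⟨x, hx⟩ := ιMulti_conjTensor_mem_range (I ∘ (finRotate (m + 2)).symm)
      (hI.comp (Equiv.injective _))
    have h2 : (Fin.snoc (fun j : Fin (m + 1) => e ((I ∘ (finRotate (m + 2)).symm) j.succ))
        (e ((I ∘ (finRotate (m + 2)).symm) 0)) : Fin (m + 2) → HInf) = fun t => e (I t) := by
      ext1 t
      refine Fin.lastCases ?_ (fun j => ?_) t
      · rw [Fin.snoc_last, Function.comp_apply, h0]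
      · rw [Fin.snoc_castSucc, Function.comp_apply, h1]
    rw [h2, Function.comp_apply, h0, ← hx] at h
    refine ⟨N⁻¹ • x, ?_⟩
    have h3 : cIota (m + 1) x = N • (exteriorPower.ιMulti ℚ (m + 2) fun t => e (I t)) ⊗ₜ[ℚ]
      eDual (I (Fin.last (m + 1))) := h
    rw [map_smul, h3, smul_smul, inv_mul_cancel₀ hN.ne', one_smul]

end AlbaneseIA

end

open AlbaneseIA
theorem corollary4p4 (i : ℕ) (hi : 1 ≤ i) :
    (∃ ρ : Representation ℚ GLInf (AlbaneseHomology IAInf i),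
      (∀ g x, johnsonAlbanese i (ρ g x) = extURep i g (johnsonAlbanese i x)) ∧
      (∀ g x, cIota i (ρ g x) = extDualRep (i + 1) g (cIota i x))) ∧
    Function.Surjective (cIota i) ∧
    ¬ FiniteDimensional ℚ (AlbaneseHomology IAInf i) ∧
    ¬ FiniteDimensional ℚ (HQ IAInf i) := by
  obtain ⟨m, rfl⟩ : ∃ m, i = m + 1 := ⟨i - 1, by omega⟩
  obtain ⟨ρ, hρ⟩ := exists_representation_johnsonAlbanese (m + 1)
  have hc : ∀ g x, cIota (m + 1) (ρ g x) = extDualRep (m + 2) g (cIota (m + 1) x) := by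
    intro g x
    -- Equivariance of `c_i ι_i` needs no second construction: it is that of `j_i` followed by that
    -- of the contraction on all of `⋀ⁱ U`.
    have h := congrArg (fun y => contraction (m + 1) (iota (m + 1) y)) (hρ g x)
    exact h.trans (contraction_iota_equivariant m g (johnsonAlbanese (m + 1) x))
  have hsurj : Function.Surjective (cIota (m + 1)) :=
    LinearMap.range_eq_top.mp (range_cIota_eq_top ρ hc)
  have hA : ¬ FiniteDimensional ℚ (AlbaneseHomology IAInf (m + 1)) := fun _ =>
    not_finite_exteriorPower_tensor_HDual (m + 2) (Module.Finite.of_surjective _ hsurj)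
  refine ⟨⟨ρ, hρ, hc⟩, hsurj, hA, fun _ => hA ?_⟩
  -- Albanese homology is a quotient of `H_i(IA_∞, ℚ)`, so finite dimension of the latter would pass
  -- to it.
  exact Module.Finite.range (HQ.map (Abelianization.of (G := IAInf)) (m + 1))
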